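/- Let $\Gamma$ be an abelian group with an injective endomorphism $F$ such that $\Gamma$ is finitely generated as a $\mathbb Z[F]$-module. For an endomorphism $G$ of $\Gamma$ and a word $\sigma=a_0a_1\cdots a_k$ with letters in $\Gamma$, put $[\sigma]_G=a_0+G(a_1)+\dots+G^k(a_k)$ (and $[\lambda]_G=0$ for the empty word $\lambda$). A finite set $\Sigma\subseteq\Gamma$ with $0\in\Sigma=-\Sigma$ is *$G$-spanning* if (C1) every $g\in\Gamma$ equals $[\sigma]_G$ for some $\sigma\in\Sigma^*$; (C2) $a_1+a_2+a_3\in\Sigma+G(\Sigma)$ for all $a_1,a_2,a_3\in\Sigma$; (C3) if $a_1,a_2\in\Sigma$, $b\in\Gamma$ and $a_1+a_2=G(b)$, then $b\in\Sigma$. The *convolution* of words $\sigma_1,\dots,\sigma_n\in\Sigma^*$ is the word over $(\Sigma\cup\{\sharp\})^n$ obtained by padding the $\sigma_i$ on the right with $\sharp$ to their maximal length and reading them in parallel; a relation on $\Sigma^*$ is *regular* if the convolutions of its members form a regular language. A set $A\subseteq\Gamma^n$ is *$F$-automatic* if there are $m>0$ and an $F^m$-spanning set $\Sigma'$ such that the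 relation $\{(\sigma_1,\dots,\sigma_n)\in(\Sigma'^*)^n : ([\sigma_1]_{F^m},\dots,[\sigma_n]_{F^m})\in A\}$ is regular. A structure in a finite language is *FA-presentable* if there are a regular language $D$ over a finite alphabet and a surjection $\nu$ from $D$ onto its domain such that the preimages under $\nu$ of equality, of the basic relations and of the graphs of the basic functions are regular relations. Let $\Sigma$ be an $F$-spanning set with $\Sigma\cap F(\Gamma)=\{0\}$, and let $\Sigma_0\subseteq\Sigma$ contain $0$ and exactly one representative of each class of $\Sigma$ modulo $F(\Gamma)$. Put * $I_{F,a}=\{F^k(a):k\ge 0\}$ for $a\in\Sigma\setminus\{0\}$, and $I_F=\bigcup_{a\in\Sigma\setminus\{0\}}I_{F,a}$; * $F^i(a)\preceq F^j(b)$ if and only if $i\le j$ (for $a,b\in\Sigma\setminus\{0\}$), and moreover $u\preceq 0$ for every $u\in I_F\cup\{0\}$; * $V_F(0)=0$, and for $g\ne 0$, $V_F(g)=F^m(b_m)$, where $g=\sum_{i=m}^k F^i(b_i)$ with $b_m\in\Sigma_0\setminus\{0\}$ and $b_i\in\Sigma$ for $m<i\le k$ (such a representation exists, and $F^m(b_m)$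 does not depend on its choice); * $R(g,u)$ if and only if either $g=u=0$, or $g=\sum_{i=0}^k F^i(a_i)$ with $a_i\in\Sigma$, $a_k\neq0$ and $u=F^k(a_k)$. Theorem. The structure $\Gamma_V=(\Gamma,+,F,V_F,R,I_F,\preceq,I_{F,a};\,a\in\Sigma\setminus\{0\})$ is FA-presentable, and for every $n$ and every $A\subseteq\Gamma^n$, $A$ is definable in $\Gamma_V$ (with or without parameters) if and only if $A$ is $F$-automatic. -/

import Mathlib

universe u v w

namespace FAutomata

section Words

variable {Γ : Type u} [AddCommGroup Γ]

/-- The element `[a₀ a₁ ⋯ aₙ]_F = a₀ + F a₁ + ⋯ + Fⁿ aₙ` represented by a word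
(the empty word represents `0`). -/
def wordValue (F : Module.End ℤ Γ) : List Γ → Γ
  | [] => 0
  | a :: w => a + F (wordValue F w)

/-- `S` is an `F`-spanning set: a finite symmetric subset of `Γ` containing `0` with the properties
(C1), (C2), (C3). By (C1) such a set generates `Γ` as a `ℤ[F]`-module. -/
structure IsSpanning (F : Module.End ℤ Γ) (S : Finset Γ) : Prop where
  zero_mem : (0 : Γ) ∈ S
  neg_mem : ∀ a ∈ S, -a ∈ S
  /-- (C1) every element of `Γ` is represented by a word over `S` -/
  exists_word : ∀ g : Γ, ∃ w : List Γ, (∀ a ∈ w, a ∈ S) ∧ wordValue F w = g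
  /-- (C2) `S + S + S ⊆ S + F(S)` -/
  add_add_mem : ∀ a₁ ∈ S, ∀ a₂ ∈ S, ∀ a₃ ∈ S, ∃ b ∈ S, ∃ c ∈ S, a₁ + a₂ + a₃ = b + F c
  /-- (C3) if `a₁ + a₂ = F b` with `a₁, a₂ ∈ S`, then `b ∈ S` -/
  mem_of_add_eq : ∀ a₁ ∈ S, ∀ a₂ ∈ S, ∀ b : Γ, a₁ + a₂ = F b → b ∈ S

end Words

section Convolution

variable {α : Type u} {n : ℕ}

/-- The convolution of `n` words: the word over the alphabet of `n`-tuples of letters or `♯`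
whose `i`-th row is the `i`-th word, filled up on the right with `♯` (here `none`) to the maximal
length. -/
def convolution (w : Fin n → List α) : List (Fin n → Option α) :=
  (List.range (Finset.univ.sup fun i => (w i).length)).map fun k i => (w i)[k]?

/-- A relation between words is regular if the language of all convolutions of its members is
regular. -/
def RegularRel (X : Set (Fin n → List α)) : Prop :=
  Language.IsRegular (convolution '' X : Language (Fin n → Option α))

end Convolution

section Automatic

variable {Γ : Type u} [AddCommGroup Γ]

/-- `A ⊆ Γⁿ` is `F`-automatic: for some `m > 0` and some `F^m`-spanning set `S`, the relation
of all `n`-tuples of words over `S` which represent (with respect to `F^m`) a member of `A` is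
regular. -/
def IsFAutomatic (F : Module.End ℤ Γ) {n : ℕ} (A : Set (Fin n → Γ)) : Prop :=
  ∃ m : ℕ, 0 < m ∧ ∃ S : Finset Γ, IsSpanning (F ^ m) S ∧
    RegularRel {w : Fin n → List S |
      (fun i => wordValue (F ^ m) ((w i).map Subtype.val)) ∈ A}

end Automatic

section Presentable

variable {α : Type} {M : Type w}

/-- The tuples of words of `D` that represent, through `ν`, a tuple in `X ⊆ Mⁿ`. -/
def representatives {D : Language α} (ν : {x : List α // x ∈ D} → M) {n : ℕ}
    (X : Set (Fin n → M)) : Set (Fin n → List α) :=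
  {x | ∃ h : ∀ i, x i ∈ D, (fun i => ν ⟨x i, h i⟩) ∈ X}

/-- A structure `M` (in a finite language) is FA-presentable: over some finite alphabet, its
elements are represented by the words of a regular language `D`, in such a way that equality,
the relations of `M` and the graphs of the functions of `M` become regular relations. -/
def FAPresentable (L : FirstOrder.Language.{u, v}) (M : Type w) [L.Structure M] : Prop :=
  ∃ (α : Type) (_ : Finite α) (D : Language α) (ν : {x : List α // x ∈ D} → M),
    D.IsRegular ∧ Function.Surjective ν ∧
    RegularRel (representatives ν {x : Fin 2 → M | x 0 = x 1}) ∧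
    (∀ (n : ℕ) (r : L.Relations n),
      RegularRel (representatives ν {x : Fin n → M | FirstOrder.Language.Structure.RelMap r x})) ∧
    ∀ (n : ℕ) (f : L.Functions n),
      RegularRel (representatives ν {x : Fin (n + 1) → M |
        FirstOrder.Language.Structure.funMap f (fun i => x i.castSucc) = x (Fin.last n)})

end Presentable

section Expansion

variable {Γ : Type u} [AddCommGroup Γ]

/-- `S₀ ⊆ S` contains `0` and exactly one representative of each class of `S` modulo `F(Γ)`. -/
structure IsTransversal (F : Module.End ℤ Γ) (S S₀ : Finset Γ) : Prop where
  subset : S₀ ⊆ S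
  zero_mem : (0 : Γ) ∈ S₀
  existsUnique : ∀ a ∈ S, ∃! b, b ∈ S₀ ∧ ∃ x : Γ, a - b = F x

/-- `I_{F,a} = {Fⁿ a : n ∈ ℕ}`. -/
def orbit (F : Module.End ℤ Γ) (a : Γ) : Set Γ := {g | ∃ n : ℕ, g = (F ^ n) a}

/-- `I_F = {Fⁿ a : a ∈ S \ {0}, n ∈ ℕ}`. -/
def orbits (F : Module.End ℤ Γ) (S : Finset Γ) : Set Γ :=
  {g | ∃ a ∈ S, a ≠ 0 ∧ ∃ n : ℕ, g = (F ^ n) a}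

/-- The preorder `⪯` on `I_F ∪ {0}`: `Fⁱ a ⪯ Fʲ b` iff `i ≤ j`, and `0` is strictly above all
elements of `I_F`. -/
def Preceq (F : Module.End ℤ Γ) (S : Finset Γ) (x y : Γ) : Prop :=
  (∃ a ∈ S, a ≠ 0 ∧ ∃ b ∈ S, b ≠ 0 ∧ ∃ i j : ℕ, i ≤ j ∧ x = (F ^ i) a ∧ y = (F ^ j) b) ∨
  ((x ∈ orbits F S ∨ x = 0) ∧ y = 0)

/-- `R(g, x)`: `x = Fⁿ a` with `a ∈ S \ {0}`, and `g` is represented by a word over `S` whose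
last letter is `a`, in position `n` (the positions are `0, 1, …, n`). Moreover `R(0, 0)`. -/
def LastTerm (F : Module.End ℤ Γ) (S : Finset Γ) (g x : Γ) : Prop :=
  (∃ a ∈ S, a ≠ 0 ∧ ∃ w : List Γ, (∀ b ∈ w, b ∈ S) ∧
    g = wordValue F (w ++ [a]) ∧ x = (F ^ w.length) a) ∨
  (g = 0 ∧ x = 0)

/-- `x = F^m b` is the first term of a representation
`g = F^m b + F^(m+1) b₁ + ⋯ + F^(m+k) b_k` with `b ∈ S₀ \ {0}` and `b₁, …, b_k ∈ S`. -/
def IsFirstTerm (F : Module.End ℤ Γ) (S S₀ : Finset Γ) (g x : Γ) : Prop :=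
  ∃ m : ℕ, ∃ b ∈ S₀, b ≠ 0 ∧ ∃ w : List Γ, (∀ c ∈ w, c ∈ S) ∧
    g = (F ^ m) (wordValue F (b :: w)) ∧ x = (F ^ m) b

open Classical in
/-- The function `V_F`: the first term of `g ≠ 0`, and `V_F(0) = 0`. -/
noncomputable def firstTerm (F : Module.End ℤ Γ) (S S₀ : Finset Γ) (g : Γ) : Γ :=
  if h : g ≠ 0 ∧ ∃ x, IsFirstTerm F S S₀ g x then h.2.choose else 0

theorem exists_isFirstTerm {F : Module.End ℤ Γ} {S S₀ : Finset Γ} (hS : IsSpanning F S)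
    (hSF : ∀ a ∈ S, ∀ x : Γ, a = F x → a = 0) (hS₀ : IsTransversal F S S₀) {g : Γ} (hg : g ≠ 0) :
    ∃ x, IsFirstTerm F S S₀ g x := by
  obtain ⟨w, hw, rfl⟩ := hS.exists_word g
  induction w with
  | nil => exact absurd rfl hg
  | cons a w ih =>
    by_cases ha : a = 0
    · subst ha
      have hg' : wordValue F w ≠ 0 := fun h => hg (by simp [wordValue, h])
      obtain ⟨_, m, b, hb, hb0, v, hv, hwv, rfl⟩ :=
        ih (fun c hc => hw c (List.mem_cons_of_mem _ hc)) hg'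
      refine ⟨(F ^ (m + 1)) b, m + 1, b, hb, hb0, v, hv, ?_, rfl⟩
      simp only [wordValue, zero_add] at hwv ⊢
      rw [hwv, pow_succ']
      rfl
    · obtain ⟨b, ⟨hb, x, hx⟩, -⟩ := hS₀.existsUnique a (hw a (by simp))
      obtain ⟨v, hv, hvx⟩ := hS.exists_word (x + wordValue F w)
      refine ⟨(F ^ 0) b, 0, b, hb, ?_, v, hv, ?_, rfl⟩
      · rintro rfl
        exact ha (hSF a (hw a (by simp)) x (by simpa using hx))
      · simp only [wordValue, pow_zero, Module.End.one_apply, hvx, map_add, ← hx]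
        abel

theorem IsFirstTerm.unique {F : Module.End ℤ Γ} (hF : Function.Injective F) {S S₀ : Finset Γ}
    (hSF : ∀ a ∈ S, ∀ x : Γ, a = F x → a = 0) (hS₀ : IsTransversal F S S₀) {g x y : Γ}
    (hx : IsFirstTerm F S S₀ g x) (hy : IsFirstTerm F S S₀ g y) : x = y := by
  obtain ⟨m, b, hb, hb0, v, -, hgv, rfl⟩ := hx
  obtain ⟨n, c, hc, hc0, w, -, hgw, rfl⟩ := hy
  have key : ∀ m n : ℕ, ∀ b ∈ S₀, b ≠ 0 → ∀ (s t c : Γ),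
      (F ^ m) (b + F s) = (F ^ n) (c + F t) → n ≤ m := by
    intro m n b hb hb0 s t c h
    by_contra hlt
    obtain ⟨k, rfl⟩ := Nat.exists_eq_add_of_lt (not_le.mp hlt)
    rw [add_assoc, pow_add, Module.End.mul_apply] at h
    have h' : b + F s = (F ^ (k + 1)) (c + F t) := by
      rw [Module.End.coe_pow] at h
      exact hF.iterate m h
    rw [pow_succ', Module.End.mul_apply] at h'
    refine hb0 (hSF b (hS₀.subset hb) ((F ^ k) (c + F t) - s) ?_)
    rw [map_sub, ← h', add_sub_cancel_right]
  have heq := hgv.symm.trans hgw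
  simp only [wordValue] at heq
  have hmn : m = n := le_antisymm (key _ _ c hc hc0 _ _ _ heq.symm) (key _ _ b hb hb0 _ _ _ heq)
  subst hmn
  have h' : b + F (wordValue F v) = c + F (wordValue F w) := by
    rw [Module.End.coe_pow] at heq
    exact hF.iterate m heq
  obtain ⟨d, -, hd⟩ := hS₀.existsUnique b (hS₀.subset hb)
  have h1 := hd b ⟨hb, 0, by simp⟩
  have h2 := hd c ⟨hc, wordValue F w - wordValue F v, by
    rw [map_sub, sub_eq_sub_iff_add_eq_add, h', add_comm]⟩
  rw [h1, h2]

/-- `V_F` is well defined. -/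
theorem firstTerm_eq_iff {F : Module.End ℤ Γ} (hF : Function.Injective F) {S S₀ : Finset Γ}
    (hS : IsSpanning F S) (hSF : ∀ a ∈ S, ∀ x : Γ, a = F x → a = 0)
    (hS₀ : IsTransversal F S S₀) {g x : Γ} (hg : g ≠ 0) :
    firstTerm F S S₀ g = x ↔ IsFirstTerm F S S₀ g x := by
  have h : g ≠ 0 ∧ ∃ x, IsFirstTerm F S S₀ g x := ⟨hg, exists_isFirstTerm hS hSF hS₀ hg⟩
  have hc : IsFirstTerm F S S₀ g (firstTerm F S S₀ g) := by
    rw [firstTerm, dif_pos h]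
    exact h.2.choose_spec
  exact ⟨fun e => e ▸ hc, fun hx => hc.unique hF hSF hS₀ hx⟩

/-- The function symbols `+`, `F`, `V_F`. -/
inductive ExpansionFunctions : ℕ → Type
  | add : ExpansionFunctions 2
  | endo : ExpansionFunctions 1
  | first : ExpansionFunctions 1

/-- The relation symbols `R`, `I_F`, `⪯` and `I_{F,a}` for `a ∈ S \ {0}`. -/
inductive ExpansionRelations (S : Finset Γ) : ℕ → Type u
  | last : ExpansionRelations S 2
  | orbits : ExpansionRelations S 1
  | preceq : ExpansionRelations S 2
  | orbit (a : {a : Γ // a ∈ S ∧ a ≠ 0}) : ExpansionRelations S 1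

/-- The language `{+, F, V_F, R, I_F, ⪯, I_{F,a} : a ∈ S \ {0}}`. -/
def expansionLanguage (S : Finset Γ) : FirstOrder.Language :=
  ⟨ExpansionFunctions, ExpansionRelations S⟩

/-- The structure `Γ_V = (Γ, +, F, V_F, R, I_F, ⪯, I_{F,a} : a ∈ S \ {0})`. -/
@[reducible]
noncomputable def expansion (F : Module.End ℤ Γ) (S S₀ : Finset Γ) :
    (expansionLanguage S).Structure Γ where
  funMap := fun {_} f => match f with
    | .add => fun x => x 0 + x 1
    | .endo => fun x => F (x 0)
    | .first => fun x => firstTerm F S S₀ (x 0)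
  RelMap := fun {_} r => match r with
    | .last => fun x => LastTerm F S (x 0) (x 1)
    | .orbits => fun x => x 0 ∈ orbits F S
    | .preceq => fun x => Preceq F S (x 0) (x 1)
    | .orbit a => fun x => x 0 ∈ orbit F a.1

end Expansion

end FAutomata

/-! Definable implies automatic. Tuples are read as words of columns over Σ. Appending zero columns
does not change the value, so complement, intersection and projection of sets of tuples become the
same operations on regular languages, the last one up to trailing zeros. It remains to recognize the
basic relations. For equality, `+` and `F` an automaton reads from the lowest digit and stores a
carry; (C2), Σ ∩ F(Γ) = {0} and injectivity of `F` keep the carry in the finite set Σ + Σ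
(`mem_carries_of_add_eq`). The other relations prescribe the shape of a word around one marked
column (`isRegular_phaseLanguage`). The same automata give the FA-presentation, with the value of a
word as ν.

Automatic implies definable. Fix a ≠ 0 in Σ, let Fⁱ(a) stand for i, and code a finite X ⊆ ℕ by the
sum of Fⁱ(a) over i ∈ X. Representations over Σ are not unique, so digits cannot be read off in
general. But two short words that agree modulo Fⁱ(Γ) differ by Fⁱ(c) with c ∈ Σ, and if the elements
of X are at least three apart, this carry cannot imitate or hide a digit (`isTruncation_iff`). Hence
membership in X is definable from `R`, `V_F` and `⪯`.

A run of an automaton over base-Fᵐ digits is coded by finitely many sets of positions, one for each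
triple of state, last letter, and step number modulo 3; the counter provides the gaps. That the sets
come from an accepting run is a local condition (`TracesPath`). The tuple that has been read is a
finite sum of elements `sumAt F X t`, and the relation between such an element and the code of X is
definable for every t ∈ Γ (`DefinablePred.exists_sumAt_pair`), so the Fᵐ-spanning set need not be
related to Σ. -/

namespace FAutomata

/-! ### Regular languages: derivatives, marked words, projections. -/

section RegularLanguages

variable {Λ : Type v}

theorem isRegular_of_eval {σ : Type w} [Finite σ] (M : DFA Λ σ) {L : Language Λ}
    (h : ∀ x, x ∈ L ↔ M.eval x ∈ M.accept) : L.IsRegular := by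
  have := Fintype.ofFinite σ
  exact Language.isRegular_iff.2 ⟨σ, inferInstance, M, Language.ext fun x => (h x).symm⟩

theorem isRegular_comap {Λ' : Type w} (f : Λ' → Λ) {L : Language Λ} (hL : L.IsRegular) :
    Language.IsRegular ({x | x.map f ∈ L} : Language Λ') := by
  obtain ⟨σ, _, M, rfl⟩ := hL
  refine isRegular_of_eval (M.comap f) fun x => ?_
  rw [DFA.eval_comap]
  rfl

/-- A family of languages, indexed by a finite set, that is closed under taking the derivative
by a letter (up to the empty language) consists of regular languages. -/
theorem isRegular_of_derivatives {ι : Type w} (C : Set ι) (hC : C.Finite) (L : ι → Language Λ)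
    (h : ∀ d ∈ C, ∀ c : Λ, (∃ e ∈ C, ∀ x, c :: x ∈ L d ↔ x ∈ L e) ∨ ∀ x, c :: x ∉ L d)
    {d : ι} (hd : d ∈ C) : (L d).IsRegular := by
  apply Language.IsRegular.of_finite_range_leftQuotient
  refine ((hC.image L).union (Set.finite_singleton (0 : Language Λ))).subset ?_
  rintro _ ⟨x, rfl⟩
  induction x generalizing d with
  | nil => exact Or.inl ⟨d, hd, rfl⟩
  | cons c x ih =>
    rcases h d hd c with ⟨e, he, hde⟩ | h0
    · have : (L d).leftQuotient (c :: x) = (L e).leftQuotient x :=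
        Language.ext fun y => hde (x ++ y)
      rw [this]
      exact ih he
    · refine Or.inr (Language.ext fun y => ?_)
      exact iff_of_false (h0 (x ++ y)) (Language.notMem_zero y)

/-- The words over letters satisfying `p`, followed by one letter satisfying `q` and letters
satisfying `r`. -/
def phaseLanguage (p q r : Λ → Prop) : Language Λ :=
  {x | ∃ y c z, x = y ++ c :: z ∧ (∀ a ∈ y, p a) ∧ q c ∧ ∀ a ∈ z, r a}

/-- Guessing the marked letter costs nothing: two truth values suffice as the state, namely whether
all letters so far satisfy `p` and whether the word read so far is already in the language. -/
theorem isRegular_phaseLanguage (p q r : Λ → Prop) : (phaseLanguage p q r).IsRegular := by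
  let M : DFA Λ (Prop × Prop) :=
    ⟨fun s c => (s.1 ∧ p c, s.1 ∧ q c ∨ s.2 ∧ r c), (True, False), {s | s.2}⟩
  have key : ∀ x, M.eval x = ((∀ a ∈ x, p a), x ∈ phaseLanguage p q r) := by
    intro x
    induction x using List.reverseRecOn with
    | nil =>
      simp only [DFA.eval_nil, M]
      ext
      · simp
      · refine iff_of_false id ?_
        rintro ⟨y, c, z, h, -⟩
        simp at h
    | append_singleton x c ih =>
      rw [DFA.eval_append_singleton, ih]
      ext
      · simp only [M, List.mem_append, List.mem_singleton]
        constructor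
        · rintro ⟨h, hc⟩ a (ha | rfl)
          exacts [h a ha, hc]
        · exact fun h => ⟨fun a ha => h a (Or.inl ha), h c (Or.inr rfl)⟩
      · simp only [M]
        constructor
        · rintro (⟨h, hc⟩ | ⟨⟨y, d, z, rfl, hy, hd, hz⟩, hc⟩)
          · exact ⟨x, c, [], rfl, h, hc, by simp⟩
          · refine ⟨y, d, z ++ [c], by simp, hy, hd, ?_⟩
            intro a ha
            rcases List.mem_append.1 ha with ha | ha
            · exact hz a ha
            · rwa [List.mem_singleton.1 ha]
        · rintro ⟨y, d, z, h, hy, hd, hz⟩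
          rcases List.eq_nil_or_concat z with rfl | ⟨z, e, rfl⟩
          · obtain ⟨rfl, h⟩ := List.append_inj' h rfl
            obtain rfl : c = d := by simpa using h
            exact Or.inl ⟨hy, hd⟩
          · have h' : x ++ [c] = (y ++ d :: z) ++ [e] := by simpa using h
            obtain ⟨rfl, h'⟩ := List.append_inj' h' rfl
            obtain rfl : c = e := by simpa using h'
            exact Or.inr ⟨⟨y, d, z, rfl, hy, hd, fun a ha => hz a (by simp [ha])⟩,
              hz c (by simp)⟩
  refine isRegular_of_eval M fun x => ?_
  rw [key]
  rfl

/-- The image of a regular language under a map of letters, after removing any number of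
occurrences of a letter `z` at the end. -/
theorem isRegular_projection {Λ' : Type w} (r : Λ' → Λ) (z : Λ) {L : Language Λ'}
    (hL : L.IsRegular) :
    Language.IsRegular ({x | ∃ y ∈ L, ∃ N, y.map r = x ++ List.replicate N z} : Language Λ) := by
  obtain ⟨σ, _, M, rfl⟩ := hL
  -- Subset construction. A preimage may be longer than the word that is read, so a set of states
  -- accepts if some number of further letters `z` leads to an accepting state of `M`.
  let f : Set σ → Λ → Set σ := fun s c => {q | ∃ p ∈ s, ∃ c', r c' = c ∧ q = M.step p c'}
  let N : DFA Λ (Set σ) :=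
    ⟨f, {M.start}, {s | ∃ N, ∃ q ∈ (List.replicate N z).foldl f s, q ∈ M.accept}⟩
  have key : ∀ x q, q ∈ x.foldl f {M.start} ↔ ∃ y, y.map r = x ∧ q = M.eval y := by
    intro x
    induction x using List.reverseRecOn with
    | nil =>
      intro q
      simp
    | append_singleton x c ih =>
      intro q
      rw [List.foldl_append]
      constructor
      · rintro ⟨p, hp, c', rfl, rfl⟩
        obtain ⟨y, rfl, rfl⟩ := (ih p).1 hp
        exact ⟨y ++ [c'], by simp, by simp⟩
      · rintro ⟨y, hy, rfl⟩
        rcases List.eq_nil_or_concat y with rfl | ⟨y, e, rfl⟩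
        · simp at hy
        · rw [List.concat_eq_append, List.map_append] at hy
          obtain ⟨rfl, h'⟩ := List.append_inj' hy rfl
          refine ⟨M.eval y, (ih _).2 ⟨y, rfl, rfl⟩, e, by simpa using h', by simp⟩
  refine isRegular_of_eval N fun x => ?_
  have hx : ∀ n, (List.replicate n z).foldl f (N.eval x) =
      (x ++ List.replicate n z).foldl f {M.start} := fun n => by
    rw [List.foldl_append]
    rfl
  constructor
  · rintro ⟨y, hy, n, hn⟩
    refine ⟨n, M.eval y, ?_, hy⟩
    rw [hx, key]
    exact ⟨y, hn, rfl⟩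
  · rintro ⟨n, q, hq, hqa⟩
    rw [hx, key] at hq
    obtain ⟨y, hy, rfl⟩ := hq
    exact ⟨y, hqa, n, hy⟩

end RegularLanguages

/-! ### Values of words and of the rows of a word of columns. -/

section WordValue

variable {Γ : Type u} [AddCommGroup Γ] (F : Module.End ℤ Γ)

theorem wordValue_append (x y : List Γ) :
    wordValue F (x ++ y) = wordValue F x + (F ^ x.length) (wordValue F y) := by
  induction x with
  | nil => simp [wordValue]
  | cons a x ih =>
    simp only [List.cons_append, wordValue, ih, map_add, List.length_cons, pow_succ',
      Module.End.mul_apply, add_assoc]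

theorem wordValue_eq_zero {x : List Γ} (hx : ∀ a ∈ x, a = 0) : wordValue F x = 0 := by
  induction x with
  | nil => rfl
  | cons a x ih =>
    rw [wordValue, ih fun b hb => hx b (List.mem_cons_of_mem _ hb), hx a List.mem_cons_self]
    simp

theorem wordValue_map_add {β : Type v} (f g : β → Γ) (x : List β) :
    wordValue F (x.map fun b => f b + g b) = wordValue F (x.map f) + wordValue F (x.map g) := by
  induction x with
  | nil => simp [wordValue]
  | cons a x ih =>
    simp only [List.map_cons, wordValue, ih, map_add]
    abel

theorem wordValue_map_sub {β : Type v} (f g : β → Γ) (x : List β) :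
    wordValue F (x.map fun b => f b - g b) = wordValue F (x.map f) - wordValue F (x.map g) := by
  induction x with
  | nil => simp [wordValue]
  | cons a x ih =>
    simp only [List.map_cons, wordValue, ih, map_sub]
    abel

theorem wordValue_map_endo {β : Type v} (f : β → Γ) (x : List β) :
    wordValue F (x.map fun b => F (f b)) = F (wordValue F (x.map f)) := by
  induction x with
  | nil => simp [wordValue]
  | cons a x ih => simp only [List.map_cons, wordValue, ih, map_add]

/-- The values of the rows of a word of columns. -/
def rowValue {ι : Type v} {α : Type w} (val : α → Γ) (x : List (ι → α)) (i : ι) : Γ :=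
  wordValue F (x.map fun c => val (c i))

theorem rowValue_map {ι κ : Type*} {α β : Type*} (val : α → Γ) (f : (κ → β) → ι → α)
    (val' : β → Γ) (i : ι) (j : κ) (h : ∀ c, val (f c i) = val' (c j)) (x : List (κ → β)) :
    rowValue F val (x.map f) i = rowValue F val' x j := by
  simp [rowValue, Function.comp_def, h]

theorem rowValue_append_replicate {ι : Type v} {α : Type w} {val : α → Γ} {z : α} (hz : val z = 0)
    (x : List (ι → α)) (n : ℕ) :
    rowValue F val (x ++ List.replicate n fun _ => z) = rowValue F val x := by
  funext i
  rw [rowValue, List.map_append, wordValue_append, List.map_replicate,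
    wordValue_eq_zero F (x := List.replicate _ _) (by simp [hz]), map_zero, add_zero, rowValue]

end WordValue

/-! ### Convolutions form a regular language. -/

section Convolution

variable {α : Type u} {n : ℕ}

theorem convolution_nil {x : Fin n → List α} (hx : ∀ i, x i = []) : convolution x = [] := by
  simp [convolution, hx]

theorem convolution_cons {x : Fin n → List α} (hx : ∃ i, x i ≠ []) :
    convolution x = (fun i => (x i)[0]?) :: convolution fun i => (x i).tail := by
  have h : (Finset.univ.sup fun i => (x i).length) =
      (Finset.univ.sup fun i => ((x i).tail).length) + 1 := by
    apply le_antisymm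
    · refine Finset.sup_le fun i _ => ?_
      have : ((x i).tail).length ≤ Finset.univ.sup fun i => ((x i).tail).length :=
        Finset.le_sup (f := fun i => ((x i).tail).length) (Finset.mem_univ i)
      rw [List.length_tail] at this
      omega
    · obtain ⟨i, hi⟩ := hx
      have hi' : 0 < (x i).length := List.length_pos_iff.2 hi
      have h0 : (x i).length ≤ Finset.univ.sup fun i => (x i).length :=
        Finset.le_sup (f := fun i => (x i).length) (Finset.mem_univ i)
      have : (Finset.univ.sup fun i => ((x i).tail).length) ≤
          (Finset.univ.sup fun i => (x i).length) - 1 := by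
        refine Finset.sup_le fun j _ => ?_
        rw [List.length_tail]
        exact Nat.sub_le_sub_right
          (Finset.le_sup (f := fun i => (x i).length) (Finset.mem_univ j)) 1
      omega
  rw [convolution, h, List.range_succ_eq_map, List.map_cons, List.map_map, convolution]
  congr 1
  refine List.map_congr_left fun k _ => ?_
  funext i
  simp

open Classical in
/-- The columns of a word of columns that are not padding form a decreasing sequence of nonempty
subsets of `s`. -/
def IsPadded : Finset (Fin n) → List (Fin n → Option α) → Prop
  | _, [] => True
  | s, c :: x => ({i | (c i).isSome} : Finset (Fin n)) ⊆ s ∧ (∃ i, (c i).isSome) ∧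
      IsPadded ({i | (c i).isSome} : Finset (Fin n)) x

theorem isPadded_iff (s : Finset (Fin n)) (x : List (Fin n → Option α)) :
    IsPadded s x ↔ ∃ y, convolution y = x ∧ ∀ i ∉ s, y i = [] := by
  classical
  induction x generalizing s with
  | nil => exact iff_of_true trivial ⟨fun _ => [], convolution_nil fun _ => rfl, fun _ _ => rfl⟩
  | cons c x ih =>
    simp only [IsPadded, ih]
    constructor
    · rintro ⟨hs, ⟨j, hj⟩, y, rfl, hy⟩
      let z : Fin n → List α := fun i => (c i).elim [] fun a => a :: y i
      have hzc : ∀ i, (z i)[0]? = c i := fun i => by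
        rcases h : c i with _ | a <;> simp [z, h]
      have hzy : ∀ i, (z i).tail = y i := fun i => by
        rcases h : c i with _ | a
        · simp [z, h, hy i (by simp [h])]
        · simp [z, h]
      refine ⟨z, ?_, fun i hi => ?_⟩
      · rw [convolution_cons ⟨j, fun h => ?_⟩]
        · simp only [hzc, hzy]
        · rw [← hzc, h] at hj
          simp at hj
      · have : c i = none := by
          by_contra h
          exact hi (hs (by simpa [Option.isSome_iff_ne_none] using h))
        simp [z, this]
    · rintro ⟨y, hy, hs⟩
      have hne : ∃ i, y i ≠ [] := by
        by_contra! h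
        rw [convolution_nil h] at hy
        simp at hy
      rw [convolution_cons hne] at hy
      obtain ⟨rfl, rfl⟩ := List.cons_eq_cons.1 hy
      refine ⟨fun i hi => ?_, ?_, fun i => (y i).tail, rfl, fun i hi => ?_⟩
      · by_contra h
        simp [hs i h] at hi
      · obtain ⟨i, hi⟩ := hne
        exact ⟨i, by simpa [List.length_pos_iff] using hi⟩
      · simp only [Finset.mem_filter, Finset.mem_univ, true_and] at hi
        have : y i = [] := by simpa using hi
        simp [this]

/-- The only memory needed is the set of rows that have not ended, and there are finitely many such
sets. -/
theorem isRegular_isPadded (s : Finset (Fin n)) :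
    Language.IsRegular ({x | IsPadded s x} : Language (Fin n → Option α)) := by
  classical
  refine isRegular_of_derivatives Set.univ Set.finite_univ
    (fun s => ({x | IsPadded s x} : Language (Fin n → Option α))) ?_ (Set.mem_univ s)
  intro d _ c
  by_cases h : ({i | (c i).isSome} : Finset (Fin n)) ⊆ d ∧ ∃ i, (c i).isSome
  · exact Or.inl ⟨_, Set.mem_univ ({i | (c i).isSome} : Finset (Fin n)), fun x =>
      ⟨fun hx => hx.2.2, fun hx => ⟨h.1, h.2, hx⟩⟩⟩
  · exact Or.inr fun x hx => h ⟨hx.1, hx.2.1⟩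

variable {Γ : Type v} [AddCommGroup Γ] (F : Module.End ℤ Γ)

theorem rowValue_convolution (val : α → Γ) (x : Fin n → List α) (i : Fin n) :
    rowValue F (fun o : Option α => o.elim 0 val) (convolution x) i =
      wordValue F ((x i).map val) := by
  have key : ∀ m, ∀ x : List α, x.length ≤ m →
      wordValue F ((List.range m).map fun k => (x[k]?).elim 0 val) = wordValue F (x.map val) := by
    intro m
    induction m with
    | zero =>
      intro x hx
      rw [List.length_eq_zero_iff.1 (Nat.le_zero.1 hx)]
      rfl
    | succ m ih =>
      intro x hx
      rw [List.range_succ_eq_map, List.map_cons, List.map_map]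
      cases x with
      | nil =>
        rw [wordValue, ← List.map_map, wordValue_eq_zero F (x := List.map _ _) (by simp)]
        simp [wordValue]
      | cons a x =>
        rw [wordValue, List.map_cons, wordValue, ← ih x (by simpa using hx)]
        congr 3
  rw [rowValue, convolution, List.map_map]
  exact key _ _ (Finset.le_sup (f := fun i => (x i).length) (Finset.mem_univ i))

/-- If the words of columns that represent members of `A` form a regular language, then `A` is
represented by a regular relation. -/
theorem regularRel_of_isRegular {S : Finset Γ} (hS : (0 : Γ) ∈ S) (val : α → S)
    {A : Set (Fin n → Γ)}
    (hA : Language.IsRegular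
      ({x | rowValue F Subtype.val x ∈ A} : Language (Fin n → S))) :
    RegularRel {x : Fin n → List α |
      (fun i => wordValue F ((x i).map fun a => (val a : Γ))) ∈ A} := by
  -- The padding symbol is read as the letter `0`, which leaves values unchanged; the second factor
  -- discards words that are not convolutions.
  have h := (isRegular_comap (fun (c : Fin n → Option α) i => (c i).elim ⟨0, hS⟩ val) hA).inf
    (isRegular_isPadded Finset.univ)
  refine (congrArg Language.IsRegular ?_).mpr h
  refine Language.ext fun u => ?_
  have hval : ∀ u : List (Fin n → Option α), rowValue F Subtype.val
      (u.map fun (c : Fin n → Option α) i => (c i).elim (⟨0, hS⟩ : S) val) =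
      rowValue F (fun o : Option α => o.elim 0 fun a => (val a : Γ)) u := fun u => by
    funext i
    refine rowValue_map _ _ _ _ _ _ (fun c => ?_) _
    rcases c i with _ | a <;> rfl
  constructor
  · rintro ⟨x, hx, rfl⟩
    refine ⟨?_, (isPadded_iff _ _).2 ⟨x, rfl, by simp⟩⟩
    change rowValue F _ _ ∈ A
    rw [hval, funext (rowValue_convolution F _ x)]
    exact hx
  · rintro ⟨hu, hu'⟩
    obtain ⟨x, rfl, -⟩ := (isPadded_iff _ _).1 hu'
    refine ⟨x, ?_, rfl⟩
    change rowValue F _ _ ∈ A at hu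
    rw [hval, funext (rowValue_convolution F _ x)] at hu
    exact hu

end Convolution

/-! ### Recognizable sets and their closure properties. -/

section Recognizable

variable {Γ : Type u} [AddCommGroup Γ]

/-- `A` is recognizable if the words of columns over `S` whose rows represent a member of `A` form
a regular language. -/
def IsRecognizable (F : Module.End ℤ Γ) (S : Finset Γ) {ι : Type v} (A : Set (ι → Γ)) : Prop :=
  Language.IsRegular ({x | rowValue F Subtype.val x ∈ A} : Language (ι → S))

variable {F : Module.End ℤ Γ} {S : Finset Γ} {ι : Type v} {κ : Type w}

namespace IsRecognizable

/-- There is no padding symbol, so every word of columns represents a tuple and Boolean operations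
need no correction. -/
theorem compl {A : Set (ι → Γ)} (hA : IsRecognizable F S A) : IsRecognizable F S Aᶜ :=
  Language.IsRegular.compl hA

theorem inter {A B : Set (ι → Γ)} (hA : IsRecognizable F S A) (hB : IsRecognizable F S B) :
    IsRecognizable F S (A ∩ B) :=
  Language.IsRegular.inf hA hB

theorem union {A B : Set (ι → Γ)} (hA : IsRecognizable F S A) (hB : IsRecognizable F S B) :
    IsRecognizable F S (A ∪ B) :=
  Language.IsRegular.add hA hB

theorem empty : IsRecognizable F S (∅ : Set (ι → Γ)) :=
  isRegular_of_eval (⟨fun s _ => s, (), ∅⟩ : DFA _ Unit) fun _ => Iff.rfl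

theorem univ : IsRecognizable F S (Set.univ : Set (ι → Γ)) :=
  isRegular_of_eval (⟨fun s _ => s, (), Set.univ⟩ : DFA _ Unit) fun _ => Iff.rfl

theorem forall_of_finite {τ : Type*} [Finite τ] {A : τ → Set (ι → Γ)}
    (hA : ∀ t, IsRecognizable F S (A t)) : IsRecognizable F S {v | ∀ t, v ∈ A t} := by
  classical
  have := Fintype.ofFinite τ
  have key : ∀ s : Finset τ, IsRecognizable F S {v | ∀ t ∈ s, v ∈ A t} := by
    intro s
    induction s using Finset.induction_on with
    | empty => simpa using univ
    | insert t s _ ih =>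
      convert (hA t).inter ih using 1
      ext v
      simp
  simpa using key Finset.univ

theorem exists_of_finite {τ : Type*} [Finite τ] {A : τ → Set (ι → Γ)}
    (hA : ∀ t, IsRecognizable F S (A t)) : IsRecognizable F S {v | ∃ t, v ∈ A t} := by
  convert (forall_of_finite fun t => (hA t).compl).compl using 1
  ext v
  simp

theorem preimage_comp (f : ι → κ) {A : Set (ι → Γ)} (hA : IsRecognizable F S A) :
    IsRecognizable F S {v : κ → Γ | v ∘ f ∈ A} :=
  isRegular_comap (fun (c : κ → S) => c ∘ f) hA |> fun h => by
    refine (congrArg Language.IsRegular (Language.ext fun x => ?_)).mpr h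
    have : rowValue F Subtype.val x ∘ f =
        rowValue F Subtype.val (x.map fun (c : κ → S) => c ∘ f) :=
      funext fun i =>
        (rowValue_map F _ (fun c : κ → S => c ∘ f) _ i (f i) (fun _ => rfl) x).symm
    exact Eq.to_iff (congrArg (· ∈ A) this)

end IsRecognizable

theorem exists_rowValue_eq (hS : IsSpanning F S) [Finite κ] (u : κ → Γ) :
    ∃ x : List (κ → S), rowValue F Subtype.val x = u := by
  obtain ⟨n, ⟨e⟩⟩ := Finite.exists_equiv_fin κ
  have hw : ∀ g : Γ, ∃ x : List S, wordValue F (x.map Subtype.val) = g := fun g => by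
    obtain ⟨x, hx, rfl⟩ := hS.exists_word g
    lift x to List S using hx
    exact ⟨x, rfl⟩
  choose y hy using hw
  refine ⟨(convolution fun i => y (u (e.symm i))).map
    fun c k => (c (e k)).elim ⟨0, hS.zero_mem⟩ id, ?_⟩
  funext k
  rw [rowValue_map (j := e k) (val' := fun o : Option S => o.elim 0 Subtype.val),
    rowValue_convolution, hy, e.symm_apply_apply]
  intro c
  rcases c (e k) with _ | a <;> rfl

theorem exists_map_comp_inl_inr {β : Type*} (x : List (ι → β)) (y : List (κ → β))
    (h : x.length = y.length) :
    ∃ z : List (ι ⊕ κ → β), z.map (· ∘ Sum.inl) = x ∧ z.map (· ∘ Sum.inr) = y := by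
  induction x generalizing y with
  | nil => exact ⟨[], rfl, (List.length_eq_zero_iff.1 h.symm).symm⟩
  | cons a x ih =>
    cases y with
    | nil => simp at h
    | cons b y =>
      obtain ⟨z, rfl, rfl⟩ := ih y (by simpa using h)
      exact ⟨Sum.elim a b :: z, by simp, by simp⟩

theorem exists_padding {β : Type*} (b : β) (x : List (ι → β)) (y : List (κ → β)) :
    ∃ N M, ∃ z : List (ι ⊕ κ → β), z.map (· ∘ Sum.inl) = x ++ List.replicate N (fun _ => b) ∧
      z.map (· ∘ Sum.inr) = y ++ List.replicate M (fun _ => b) :=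
  ⟨y.length, x.length, exists_map_comp_inl_inr _ _ (by simp [add_comm])⟩

theorem rowValue_map_comp {β : Type*} (val : β → Γ) (f : ι → κ) (x : List (κ → β)) :
    rowValue F val (x.map (· ∘ f)) = rowValue F val x ∘ f :=
  funext fun i => rowValue_map F _ (fun c : κ → β => c ∘ f) _ i (f i) (fun _ => rfl) x

/-- The word for the witness `u` may be longer than the given word for `v`. Both are padded with
zeros, and `isRegular_projection` removes the zero columns thus added to `v`. -/
theorem IsRecognizable.exists (hS : IsSpanning F S) [Finite κ] {A : Set (ι ⊕ κ → Γ)}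
    (hA : IsRecognizable F S A) : IsRecognizable F S {v | ∃ u : κ → Γ, Sum.elim v u ∈ A} := by
  let o : S := ⟨0, hS.zero_mem⟩
  refine (congrArg Language.IsRegular (Language.ext fun x => ?_)).mpr
    (isRegular_projection (fun c : ι ⊕ κ → S => c ∘ Sum.inl) (fun _ => o) hA)
  constructor
  · rintro ⟨u, hu⟩
    obtain ⟨y, rfl⟩ := exists_rowValue_eq hS u
    obtain ⟨N, M, z, hz, hz'⟩ := exists_padding o x y
    refine ⟨z, ?_, N, hz⟩
    rw [← rowValue_append_replicate F (z := o) rfl x N, ← hz,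
      ← rowValue_append_replicate F (z := o) rfl y M, ← hz', rowValue_map_comp,
      rowValue_map_comp, Sum.elim_comp_inl_inr] at hu
    exact hu
  · rintro ⟨z, hz, N, hN⟩
    refine ⟨rowValue F Subtype.val z ∘ Sum.inr, ?_⟩
    rw [← rowValue_append_replicate F (z := o) rfl x N, ← hN, rowValue_map_comp,
      Sum.elim_comp_inl_inr]
    exact hz

/-- The set of sums of two elements of `S`. -/
def carries (S : Finset Γ) : Set Γ := {g | ∃ a ∈ S, ∃ b ∈ S, g = a + b}

theorem finite_carries (S : Finset Γ) : (carries S).Finite := by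
  refine ((S.finite_toSet.prod S.finite_toSet).image fun p => p.1 + p.2).subset ?_
  rintro _ ⟨a, ha, b, hb, rfl⟩
  exact ⟨(a, b), ⟨ha, hb⟩, rfl⟩

/-- The state `d` is a carry. After a letter `c` the sum can vanish only if `d + f c` lies in the
image of `F`, and its preimage, unique by injectivity, is the next carry; otherwise the derivative
is empty. -/
theorem isRegular_wordValue_eq_zero (hF : Function.Injective F) {Λ : Type w} (f : Λ → Γ)
    (hf : ∀ d ∈ carries S, ∀ c g, d + f c = F g → g ∈ carries S) {d : Γ} (hd : d ∈ carries S) :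
    Language.IsRegular ({x | d + wordValue F (x.map f) = 0} : Language Λ) := by
  refine isRegular_of_derivatives (carries S) (finite_carries S)
    (fun d => ({x | d + wordValue F (x.map f) = 0} : Language Λ)) ?_ hd
  intro d hd c
  by_cases h : ∃ g, d + f c = F g
  · obtain ⟨g, hg⟩ := h
    refine Or.inl ⟨g, hf d hd c g hg, fun x => ?_⟩
    change d + (f c + F _) = 0 ↔ g + _ = 0
    rw [← add_assoc, hg, ← map_add, map_eq_zero_iff F hF]
  · refine Or.inr fun x hx => h ⟨-wordValue F (x.map f), ?_⟩
    change d + (f c + F _) = 0 at hx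
    rw [map_neg, eq_neg_iff_add_eq_zero, add_assoc]
    exact hx

theorem isRecognizable_of_linear (hF : Function.Injective F) (hS : IsSpanning F S)
    (f : (ι → S) → Γ) (φ : (ι → Γ) → Γ)
    (hφ : ∀ x : List (ι → S), wordValue F (x.map f) = φ (rowValue F Subtype.val x))
    (hf : ∀ d ∈ carries S, ∀ c g, d + f c = F g → g ∈ carries S) {d : Γ} (hd : d ∈ S) :
    IsRecognizable F S {v | d + φ v = 0} := by
  refine (congrArg Language.IsRegular (Language.ext fun x => ?_)).mpr
    (isRegular_wordValue_eq_zero hF f hf (d := d)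
      ⟨d, hd, 0, hS.zero_mem, (add_zero d).symm⟩)
  exact Eq.to_iff (congrArg (fun g => d + g = 0) (hφ x).symm)

variable (hF : Function.Injective F) (hS : IsSpanning F S)
  (hSF : ∀ a ∈ S, ∀ x : Γ, a = F x → a = 0)

include hF hS hSF

/-- By (C2) the sum is `p + F q`. Then `p` is a letter in the image of `F`, hence zero, and `g = q`.
-/
theorem mem_of_add_add_eq {a b c g : Γ} (ha : a ∈ S) (hb : b ∈ S) (hc : c ∈ S)
    (h : a + b + c = F g) : g ∈ S := by
  obtain ⟨p, hp, q, hq, hpq⟩ := hS.add_add_mem a ha b hb c hc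
  have : p = F (g - q) := by rw [map_sub, ← h, hpq, add_sub_cancel_right]
  have hp0 := hSF p hp _ this
  rw [hpq, hp0, zero_add] at h
  rwa [← hF h]

/-- This bounds the carries: (C2) splits off a letter `q` from the first three summands, and
`mem_of_add_add_eq` shows that what remains, `g - q`, is again a letter. -/
theorem mem_carries_of_add_eq {d a b c g : Γ} (hd : d ∈ carries S) (ha : a ∈ S) (hb : b ∈ S)
    (hc : c ∈ S) (h : d + a + b + c = F g) : g ∈ carries S := by
  obtain ⟨x, hx, y, hy, rfl⟩ := hd
  obtain ⟨p, hp, q, hq, hpq⟩ := hS.add_add_mem x hx y hy a ha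
  have h' : p + b + c = F (g - q) := by
    rw [map_sub, ← h, hpq]
    abel
  exact ⟨g - q, mem_of_add_add_eq hF hS hSF hp hb hc h', q, hq, by abel⟩

theorem isRecognizable_eq (i j : ι) : IsRecognizable F S {v : ι → Γ | v i = v j} := by
  convert isRecognizable_of_linear hF hS (fun c : ι → S => (c i : Γ) - c j)
    (fun v => v i - v j) (wordValue_map_sub F _ _) (fun d hd c g h => ?_) hS.zero_mem using 1
  · ext v
    simp [sub_eq_zero]
  · refine mem_carries_of_add_eq hF hS hSF hd (c i).2 (hS.neg_mem _ (c j).2) hS.zero_mem ?_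
    rw [← h]
    abel

theorem isRecognizable_add (i j k : ι) : IsRecognizable F S {v : ι → Γ | v i + v j = v k} := by
  convert isRecognizable_of_linear hF hS (fun c : ι → S => ((c i : Γ) + c j) - c k)
    (fun v => v i + v j - v k)
    (fun x => by rw [wordValue_map_sub, wordValue_map_add]; rfl) (fun d hd c g h => ?_)
    hS.zero_mem using 1
  · ext v
    simp [sub_eq_zero]
  · refine mem_carries_of_add_eq hF hS hSF hd (c i).2 (c j).2 (hS.neg_mem _ (c k).2) ?_
    rw [← h]
    abel

theorem isRecognizable_endo (i j : ι) : IsRecognizable F S {v : ι → Γ | F (v i) = v j} := by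
  convert isRecognizable_of_linear hF hS (fun c : ι → S => F (c i : Γ) - c j)
    (fun v => F (v i) - v j)
    (fun x => by rw [wordValue_map_sub, wordValue_map_endo]; rfl) (fun d hd c g h => ?_)
    hS.zero_mem using 1
  · ext v
    simp [sub_eq_zero]
  -- `F (c i)` need not be a sum of few letters, but it moves into the next carry as the summand `c
  -- i`.
  · obtain ⟨x, hx, y, hy, rfl⟩ := hd
    refine ⟨g - c i, mem_of_add_add_eq hF hS hSF hx hy (hS.neg_mem _ (c j).2) ?_, c i, (c i).2,
      by abel⟩
    rw [map_sub, ← h]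
    abel

theorem isRecognizable_eq_of_mem {a : Γ} (ha : a ∈ S) (i : ι) :
    IsRecognizable F S {v : ι → Γ | v i = a} := by
  convert isRecognizable_of_linear hF hS (fun c : ι → S => (c i : Γ))
    (fun v => v i) (fun x => rfl) (fun d hd c g h => ?_)
    (hS.neg_mem _ ha) using 1
  · ext v
    rw [Set.mem_ofPred, Set.mem_ofPred, neg_add_eq_zero, eq_comm]
  · refine mem_carries_of_add_eq hF hS hSF hd (c i).2 hS.zero_mem hS.zero_mem ?_
    rw [← h]
    abel

/-- A carry automaton can start only with an element of `S + S`, so a general constant is built up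
along a word, through `b + F (wordValue F x)`. -/
theorem isRecognizable_const (a : Γ) (i : ι) : IsRecognizable F S {v : ι → Γ | v i = a} := by
  have key : ∀ x : List Γ, (∀ b ∈ x, b ∈ S) →
      IsRecognizable F S {v : Unit → Γ | v () = wordValue F x} := by
    intro x
    induction x with
    | nil => exact fun _ => isRecognizable_eq_of_mem hF hS hSF hS.zero_mem ()
    | cons b x ih =>
      intro hx
      have h1 := (ih fun c hc => hx c (List.mem_cons_of_mem _ hc)).preimage_comp
        (fun _ : Unit => (Sum.inr 0 : Unit ⊕ Fin 3))
      have h2 := isRecognizable_endo hF hS hSF (Sum.inr 0 : Unit ⊕ Fin 3) (Sum.inr 1)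
      have h3 := isRecognizable_add hF hS hSF (Sum.inr 2) (Sum.inr 1)
        (Sum.inl () : Unit ⊕ Fin 3)
      have h4 := isRecognizable_eq_of_mem hF hS hSF (hx b List.mem_cons_self)
        (Sum.inr 2 : Unit ⊕ Fin 3)
      convert (((h1.inter h2).inter h3).inter h4).exists hS using 1
      ext v
      constructor
      · intro hv
        refine ⟨![wordValue F x, F (wordValue F x), b], ⟨⟨rfl, rfl⟩, ?_⟩, rfl⟩
        exact Eq.symm hv
      · rintro ⟨u, ⟨⟨h1, h2⟩, h3⟩, h4⟩
        simp only [Set.mem_ofPred_eq, Sum.elim_inr, Sum.elim_inl, Function.comp_apply]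
          at h1 h2 h3 h4
        change v () = b + F _
        rw [← h3, ← h2, h1, h4]
  obtain ⟨x, hx, rfl⟩ := hS.exists_word a
  exact (key x hx).preimage_comp fun _ => i

/-- The set of tuples represented by the words of a regular language that is closed under padding
is recognizable. -/
theorem isRecognizable_of_isRegular [Finite ι] {K : Language (ι → S)} (hK : K.IsRegular)
    (hpad : ∀ x ∈ K, ∀ N, x ++ List.replicate N (fun _ => ⟨0, hS.zero_mem⟩) ∈ K) :
    IsRecognizable F S {v | ∃ x ∈ K, rowValue F Subtype.val x = v} := by
  let o : S := ⟨0, hS.zero_mem⟩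
  have heq : IsRecognizable F S {v : ι ⊕ ι → Γ | ∀ i, v (Sum.inl i) = v (Sum.inr i)} :=
    IsRecognizable.forall_of_finite
      (A := fun i => {v : ι ⊕ ι → Γ | v (Sum.inl i) = v (Sum.inr i)})
      fun i => isRecognizable_eq hF hS hSF _ _
  -- A word `x` that represents a tuple in question need not lie in `K`; one projects from pairs of
  -- `x` and some `y ∈ K` of equal value. Closure under padding makes their lengths equal.
  refine (congrArg Language.IsRegular (Language.ext fun x => ?_)).mpr
    (isRegular_projection (fun c : ι ⊕ ι → S => c ∘ Sum.inl) (fun _ => o)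
      (Language.IsRegular.inf heq (isRegular_comap (fun c : ι ⊕ ι → S => c ∘ Sum.inr) hK)))
  constructor
  · rintro ⟨y, hy, hyx⟩
    obtain ⟨N, M, z, hz, hz'⟩ := exists_padding o x y
    refine ⟨z, ⟨?_, ?_⟩, N, hz⟩
    · rw [← rowValue_append_replicate F (z := o) rfl x N, ← hz,
        ← rowValue_append_replicate F (z := o) rfl y M, ← hz', rowValue_map_comp,
        rowValue_map_comp] at hyx
      exact fun i => (congrFun hyx i).symm
    · change z.map _ ∈ K
      rw [hz']
      exact hpad y hy M
  · rintro ⟨z, ⟨hz, hzK⟩, N, hN⟩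
    refine ⟨_, hzK, ?_⟩
    rw [← rowValue_append_replicate F (z := o) rfl x N, ← hN, rowValue_map_comp,
      rowValue_map_comp]
    exact funext fun i => (hz i).symm

theorem isRecognizable_phaseLanguage [Finite ι] (p q r : (ι → S) → Prop)
    (hr : r fun _ => ⟨0, hS.zero_mem⟩) :
    IsRecognizable F S {v | ∃ x ∈ phaseLanguage p q r, rowValue F Subtype.val x = v} := by
  refine isRecognizable_of_isRegular hF hS hSF (isRegular_phaseLanguage p q r) ?_
  rintro _ ⟨y, c, z, rfl, hy, hc, hz⟩ N
  refine ⟨y, c, z ++ List.replicate N fun _ => ⟨0, hS.zero_mem⟩, by simp, hy, hc, ?_⟩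
  intro a ha
  rcases List.mem_append.1 ha with ha | ha
  · exact hz a ha
  · rwa [List.eq_of_mem_replicate ha]

end Recognizable

/-! ### Sets definable over recognizable relations are recognizable. -/

section Formulas

open FirstOrder FirstOrder.Language

variable {Γ : Type u} [AddCommGroup Γ] {F : Module.End ℤ Γ} {S : Finset Γ}
  {L : FirstOrder.Language.{v, w}} [L.Structure Γ]

variable (hF : Function.Injective F) (hS : IsSpanning F S)
  (hSF : ∀ a ∈ S, ∀ x : Γ, a = F x → a = 0)
  (hfun : ∀ (n : ℕ) (f : L.Functions n),
    IsRecognizable F S {v : Fin n ⊕ Unit → Γ |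
      Structure.funMap f (v ∘ Sum.inl) = v (Sum.inr ())})
  (hrel : ∀ (n : ℕ) (r : L.Relations n),
    IsRecognizable F S {v : Fin n → Γ | Structure.RelMap r v})

include hF hS hSF hfun

/-- The graph of a composed term is obtained by quantifying over the values of the arguments, one
new row for each. -/
theorem isRecognizable_term {β : Type*} (t : L.Term β) :
    IsRecognizable F S {v : β ⊕ Unit → Γ | t.realize (v ∘ Sum.inl) = v (Sum.inr ())} := by
  induction t with
  | var b => exact isRecognizable_eq hF hS hSF (Sum.inl b) (Sum.inr ())
  | @func l f ts ih =>
    have h1 := IsRecognizable.forall_of_finite fun i => (ih i).preimage_comp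
      (Sum.elim (fun b => Sum.inl (Sum.inl b)) fun _ => Sum.inr i :
        β ⊕ Unit → (β ⊕ Unit) ⊕ Fin l)
    have h2 := (hfun l f).preimage_comp
      (Sum.elim Sum.inr fun _ => Sum.inl (Sum.inr ()) : Fin l ⊕ Unit → (β ⊕ Unit) ⊕ Fin l)
    convert (h1.inter h2).exists hS using 1
    ext v
    constructor
    · intro hv
      exact ⟨fun i => (ts i).realize (v ∘ Sum.inl), fun i => rfl, hv⟩
    · rintro ⟨u, h1, h2⟩
      have hu : (fun i => (ts i).realize (v ∘ Sum.inl)) = u := funext fun i => h1 i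
      change Structure.funMap f (fun i => (ts i).realize (v ∘ Sum.inl)) = _
      rw [hu]
      exact h2

include hrel

theorem isRecognizable_boundedFormula {α : Type*} {k : ℕ} (φ : L.BoundedFormula α k) :
    IsRecognizable F S {v : α ⊕ Fin k → Γ | φ.Realize (v ∘ Sum.inl) (v ∘ Sum.inr)} := by
  have elim_eq : ∀ {k : ℕ} (v : α ⊕ Fin k → Γ), Sum.elim (v ∘ Sum.inl) (v ∘ Sum.inr) = v :=
    fun v => Sum.elim_comp_inl_inr v
  induction φ with
  | falsum => exact IsRecognizable.empty
  | @equal k t₁ t₂ =>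
    have h1 := (isRecognizable_term hF hS hSF hfun t₁).inter
      (isRecognizable_term hF hS hSF hfun t₂)
    convert h1.exists hS using 1
    ext v
    constructor
    · intro hv
      refine ⟨fun _ => t₂.realize v, ?_, rfl⟩
      change t₁.realize (Sum.elim _ _) = t₂.realize (Sum.elim _ _) at hv
      rwa [elim_eq] at hv
    · rintro ⟨u, h1, h2⟩
      change t₁.realize (Sum.elim _ _) = t₂.realize (Sum.elim _ _)
      rw [elim_eq]
      exact Eq.trans h1 (Eq.symm h2)
  | @rel k l r ts =>
    have h1 := IsRecognizable.forall_of_finite fun i =>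
      (isRecognizable_term hF hS hSF hfun (ts i)).preimage_comp
        (Sum.elim Sum.inl fun _ => Sum.inr i :
          (α ⊕ Fin k) ⊕ Unit → (α ⊕ Fin k) ⊕ Fin l)
    have h2 := (hrel l r).preimage_comp (Sum.inr : Fin l → (α ⊕ Fin k) ⊕ Fin l)
    convert (h1.inter h2).exists hS using 1
    ext v
    constructor
    · intro hv
      refine ⟨fun i => (ts i).realize v, fun i => rfl, ?_⟩
      change Structure.RelMap r (fun i => (ts i).realize (Sum.elim _ _)) at hv
      rwa [elim_eq] at hv
    · rintro ⟨u, h1, h2⟩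
      have hu : (fun i => (ts i).realize v) = u := funext fun i => h1 i
      change Structure.RelMap r (fun i => (ts i).realize (Sum.elim _ _))
      rw [elim_eq, hu]
      exact h2
  | imp φ ψ ihφ ihψ =>
    convert ihφ.compl.union ihψ using 1
    ext v
    exact imp_iff_not_or
  | @all k φ ih =>
    have h1 := ih.compl.preimage_comp
      (Sum.elim (fun a => Sum.inl (Sum.inl a))
        (Fin.lastCases (Sum.inr ()) fun i => Sum.inl (Sum.inr i)) :
        α ⊕ Fin (k + 1) → (α ⊕ Fin k) ⊕ Unit)
    convert (h1.exists hS).compl using 1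
    ext v
    have hsnoc : ∀ u : Unit → Γ, (fun i : Fin (k + 1) => Sum.elim v u
        (Fin.lastCases (Sum.inr ()) (fun i => Sum.inl (Sum.inr i)) i : (α ⊕ Fin k) ⊕ Unit)) =
        Fin.snoc (v ∘ Sum.inr) (u ()) := by
      intro u
      funext i
      refine Fin.lastCases ?_ (fun i => ?_) i <;> simp
    have key : ∀ u : Unit → Γ, (Sum.elim v u ∈ {w : (α ⊕ Fin k) ⊕ Unit → Γ |
        w ∘ (Sum.elim (fun a => Sum.inl (Sum.inl a))
        (Fin.lastCases (Sum.inr ()) fun i => Sum.inl (Sum.inr i)) :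
        α ⊕ Fin (k + 1) → (α ⊕ Fin k) ⊕ Unit) ∈
          {v : α ⊕ Fin (k + 1) → Γ | φ.Realize (v ∘ Sum.inl) (v ∘ Sum.inr)}ᶜ}) ↔
        ¬ φ.Realize (v ∘ Sum.inl) (Fin.snoc (v ∘ Sum.inr) (u ())) := by
      intro u
      rw [← hsnoc]
      rfl
    constructor
    · rintro h ⟨u, hu⟩
      exact (key u).1 hu (h (u ()))
    · intro h x
      by_contra hx
      exact h ⟨fun _ => x, (key _).2 hx⟩

/-- If the functions and relations of a structure on `Γ` are recognizable, then so are all sets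
definable with parameters. -/
theorem isRecognizable_of_definable {α : Type*} {P : Set Γ} {A : Set (α → Γ)}
    (hA : P.Definable L A) : IsRecognizable F S A := by
  -- Only finitely many parameters occur. Each becomes a quantified variable that is tied to a
  -- constant.
  obtain ⟨P₀, -, hP₀⟩ := Set.definable_iff_finitely_definable.1 hA
  obtain ⟨φ, rfl⟩ := Set.definable_iff_exists_formula_sum.1 hP₀
  have h1 := (isRecognizable_boundedFormula hF hS hSF hfun hrel φ).preimage_comp
    (Sum.elim (Sum.elim Sum.inr Sum.inl) Fin.elim0 :
      ((P₀ : Set Γ) ⊕ α) ⊕ Fin 0 → α ⊕ (P₀ : Set Γ))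
  have h2 := IsRecognizable.forall_of_finite fun a : (P₀ : Set Γ) =>
    isRecognizable_const hF hS hSF (a : Γ) (Sum.inr a : α ⊕ (P₀ : Set Γ))
  convert (h1.inter h2).exists hS using 1
  ext v
  have key : ∀ u : ↥(P₀ : Set Γ) → Γ, (Sum.elim v u ∈ {w : α ⊕ (P₀ : Set Γ) → Γ |
      w ∘ (Sum.elim (Sum.elim Sum.inr Sum.inl) Fin.elim0 :
      ((P₀ : Set Γ) ⊕ α) ⊕ Fin 0 → α ⊕ (P₀ : Set Γ)) ∈
        {v | BoundedFormula.Realize φ (v ∘ Sum.inl) (v ∘ Sum.inr)}}) ↔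
      φ.Realize (Sum.elim u v) := by
    intro u
    rw [Formula.Realize]
    change BoundedFormula.Realize φ _ _ ↔ _
    convert Iff.rfl using 2
    · funext i
      rcases i with i | i <;> rfl
  constructor
  · intro hv
    exact ⟨Subtype.val, (key _).2 hv, fun a => rfl⟩
  · rintro ⟨u, hu, hua⟩
    rw [key] at hu
    have : u = Subtype.val := funext fun a => hua a
    rwa [this] at hu

end Formulas

/-! ### The basic relations of the expansion are recognizable. -/

section PhaseRelations

variable {Γ : Type u} [AddCommGroup Γ] {F : Module.End ℤ Γ} {S : Finset Γ}

theorem rowValue_append_cons {ι : Type*} (y : List (ι → S)) (c : ι → S) (z : List (ι → S))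
    (i : ι) : rowValue F Subtype.val (y ++ c :: z) i =
      wordValue F (y.map fun c => (c i : Γ)) +
        (F ^ y.length) (c i + F (wordValue F (z.map fun c => (c i : Γ)))) := by
  rw [rowValue, List.map_append, wordValue_append, List.length_map]
  rfl

theorem exists_map_eq (i : Fin 2) {x : List Γ} (hS : IsSpanning F S) (hx : ∀ a ∈ x, a ∈ S) :
    ∃ y : List (Fin 2 → S), y.length = x.length ∧ y.map (fun c => (c i : Γ)) = x ∧
      ∀ c ∈ y, ∀ j ≠ i, (c j : Γ) = 0 := by
  lift x to List S using hx
  refine ⟨x.map fun a j => if j = i then a else ⟨0, hS.zero_mem⟩, by simp, by simp, ?_⟩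
  intro c hc j hj
  obtain ⟨a, -, rfl⟩ := List.mem_map.1 hc
  simp [hj]

variable (hF : Function.Injective F) (hS : IsSpanning F S)
  (hSF : ∀ a ∈ S, ∀ x : Γ, a = F x → a = 0)

include hF hS hSF

/-- This serves to compare exponents: `F^j b`, with `b` a nonzero letter, is of the form `F^i g`
exactly if `i ≤ j`. -/
theorem isRecognizable_orbit_dvd {a : Γ} (ha : a ∈ S) :
    IsRecognizable F S {v : Fin 2 → Γ | ∃ n g, v 0 = (F ^ n) a ∧ v 1 = (F ^ n) g} := by
  convert isRecognizable_phaseLanguage hF hS hSF (fun c : Fin 2 → S => ∀ i, (c i : Γ) = 0)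
    (fun c => (c 0 : Γ) = a) (fun c => (c 0 : Γ) = 0) rfl using 1
  ext v
  constructor
  · rintro ⟨n, g, h0, h1⟩
    obtain ⟨x, hx⟩ := exists_rowValue_eq hS (fun _ : Unit => g)
    let w : List S := x.map fun c => c ()
    have hw : wordValue F (w.map Subtype.val) = g := by
      rw [← congrFun hx (), rowValue, List.map_map]
      rfl
    let o : S := ⟨0, hS.zero_mem⟩
    let y := w.map fun s : S => (![o, s] : Fin 2 → S)
    have hy0 : wordValue F (y.map fun c => (c 0 : Γ)) = 0 := by
      apply wordValue_eq_zero
      intro b hb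
      simp only [y, List.map_map, List.mem_map] at hb
      obtain ⟨_, -, rfl⟩ := hb
      rfl
    have hy1 : wordValue F (y.map fun c => (c 1 : Γ)) = g := by
      rw [← hw]
      simp [y, Function.comp_def]
    -- The letter `a` is written into row 0 of the first column of a word for `g`; if that word is
    -- empty, a column has to be created for it.
    rcases hyc : y with _ | ⟨c, z⟩
    · rw [hyc] at hy1
      refine ⟨List.replicate n (fun _ => o) ++ (![⟨a, ha⟩, o] : Fin 2 → S) :: [],
        ⟨_, _, _, rfl, ?_, rfl, by simp⟩, ?_⟩
      · intro c hc i
        rw [List.eq_of_mem_replicate hc]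
      · funext i
        rw [rowValue_append_cons, List.map_replicate, List.length_replicate,
          wordValue_eq_zero F fun b hb => List.eq_of_mem_replicate hb]
        fin_cases i
        · simp [h0, wordValue]
        · simp [h1, ← hy1, wordValue, o]
    · rw [hyc, List.map_cons, wordValue] at hy0 hy1
      have hmem : ∀ d ∈ c :: z, (d 0 : Γ) = 0 := by
        rw [← hyc]
        intro d hd
        obtain ⟨_, -, rfl⟩ := List.mem_map.1 hd
        rfl
      refine ⟨List.replicate n (fun _ => o) ++ (![⟨a, ha⟩, c 1] : Fin 2 → S) :: z,
        ⟨_, _, _, rfl, ?_, rfl, fun d hd => hmem d (List.mem_cons_of_mem _ hd)⟩, ?_⟩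
      · intro c hc i
        rw [List.eq_of_mem_replicate hc]
      · funext i
        rw [rowValue_append_cons, List.map_replicate, List.length_replicate,
          wordValue_eq_zero F fun b hb => List.eq_of_mem_replicate hb]
        fin_cases i
        · rw [hmem c List.mem_cons_self, zero_add] at hy0
          simp [h0, hy0]
        · simp [h1, ← hy1]
  · rintro ⟨_, ⟨y, c, z, rfl, hy, hc, hz⟩, rfl⟩
    refine ⟨y.length, c 1 + F (wordValue F (z.map fun c => (c 1 : Γ))), ?_, ?_⟩
    · rw [rowValue_append_cons, hc, wordValue_eq_zero F (x := y.map _)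
        (by simpa using fun b hb => hy b hb 0),
        wordValue_eq_zero F (x := z.map _) (by simpa using hz)]
      simp
    · rw [rowValue_append_cons, wordValue_eq_zero F (x := y.map _)
        (by simpa using fun b hb => hy b hb 1), zero_add]

theorem isRecognizable_orbit {a : Γ} (ha : a ∈ S) :
    IsRecognizable F S {v : Fin 1 → Γ | v 0 ∈ orbit F a} := by
  convert (isRecognizable_orbit_dvd hF hS hSF ha).preimage_comp fun _ => (0 : Fin 1) using 1
  ext v
  constructor
  · rintro ⟨n, h⟩
    exact ⟨n, a, h, h⟩
  · rintro ⟨n, -, h, -⟩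
    exact ⟨n, h⟩

theorem isRecognizable_orbits : IsRecognizable F S {v : Fin 1 → Γ | v 0 ∈ orbits F S} := by
  convert IsRecognizable.exists_of_finite fun a : {a : Γ // a ∈ S ∧ a ≠ 0} =>
    isRecognizable_orbit hF hS hSF a.2.1 using 1
  · ext v
    constructor
    · rintro ⟨a, ha, ha0, h⟩
      exact ⟨⟨a, ha, ha0⟩, h⟩
    · rintro ⟨⟨a, ha, ha0⟩, h⟩
      exact ⟨a, ha, ha0, h⟩
  · exact (S.finite_toSet.subset fun a ha => ha.1 : {a : Γ | a ∈ S ∧ a ≠ 0}.Finite).to_subtype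

-- After cancelling `F^j`, the inequality `j < i` would put the nonzero letter `b` into the image of
-- `F`.
omit hF hS in
theorem le_of_pow_eq_pow (hF : Function.Injective F) {i j : ℕ} {b g : Γ} (hb : b ∈ S)
    (hb0 : b ≠ 0) (h : (F ^ i) g = (F ^ j) b) : i ≤ j := by
  by_contra hij
  obtain ⟨k, rfl⟩ := Nat.exists_eq_add_of_lt (not_le.mp hij)
  rw [add_assoc, pow_add, Module.End.mul_apply, Module.End.coe_pow F j] at h
  have h' := hF.iterate j h
  rw [pow_succ', Module.End.mul_apply] at h'
  exact hb0 (hSF b hb _ h'.symm)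

theorem isRecognizable_preceq : IsRecognizable F S {v : Fin 2 → Γ | Preceq F S (v 0) (v 1)} := by
  have hfin : Finite {a : Γ // a ∈ S ∧ a ≠ 0} :=
    (S.finite_toSet.subset fun a ha => ha.1 : {a : Γ | a ∈ S ∧ a ≠ 0}.Finite).to_subtype
  have h1 := IsRecognizable.exists_of_finite fun a : {a : Γ // a ∈ S ∧ a ≠ 0} =>
    isRecognizable_orbit_dvd hF hS hSF a.2.1
  have h2 := (isRecognizable_orbits hF hS hSF).preimage_comp fun _ => (0 : Fin 2)
  have h3 := (isRecognizable_orbits hF hS hSF).preimage_comp fun _ => (1 : Fin 2)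
  have h4 := isRecognizable_const hF hS hSF 0 (0 : Fin 2)
  have h5 := isRecognizable_const hF hS hSF 0 (1 : Fin 2)
  convert (h1.inter h3).union ((h2.union h4).inter h5) using 1
  ext v
  refine or_congr ?_ Iff.rfl
  constructor
  · rintro ⟨a, ha, ha0, b, hb, hb0, i, j, hij, h0, h1⟩
    refine ⟨⟨⟨a, ha, ha0⟩, i, (F ^ (j - i)) b, h0, ?_⟩, b, hb, hb0, j, h1⟩
    rw [h1, ← Module.End.mul_apply, ← pow_add, Nat.add_sub_cancel' hij]
  · rintro ⟨⟨⟨a, ha, ha0⟩, i, g, h0, h1⟩, b, hb, hb0, j, h2⟩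
    exact ⟨a, ha, ha0, b, hb, hb0, i, j,
      le_of_pow_eq_pow hSF hF hb hb0 (h1.symm.trans h2), h0, h2⟩

theorem isRecognizable_lastTerm :
    IsRecognizable F S {v : Fin 2 → Γ | LastTerm F S (v 0) (v 1)} := by
  -- The marked column carries the last letter in both rows. Zero columns are allowed after it
  -- because the language must be closed under padding.
  have h1 := isRecognizable_phaseLanguage hF hS hSF (fun c : Fin 2 → S => (c 1 : Γ) = 0)
    (fun c => (c 0 : Γ) = c 1 ∧ (c 0 : Γ) ≠ 0) (fun c => ∀ i, (c i : Γ) = 0) fun _ => rfl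
  have h2 := isRecognizable_const hF hS hSF 0 (0 : Fin 2)
  have h3 := isRecognizable_const hF hS hSF 0 (1 : Fin 2)
  convert h1.union (h2.inter h3) using 1
  ext v
  refine or_congr ?_ Iff.rfl
  constructor
  · rintro ⟨a, ha, ha0, w, hw, h0, h1⟩
    obtain ⟨y, hy, rfl, hy0⟩ := exists_map_eq 0 hS hw
    refine ⟨y ++ (fun _ => ⟨a, ha⟩) :: [], ⟨_, _, _, rfl, fun c hc => hy0 c hc 1 (by simp),
      ⟨rfl, ha0⟩, by simp⟩, ?_⟩
    funext i
    rw [rowValue_append_cons]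
    fin_cases i
    · simp [h0, wordValue_append, wordValue]
    · rw [wordValue_eq_zero F (x := List.map _ y)
        (by simpa using fun b hb => hy0 b hb 1 (by simp))]
      simp [h1, wordValue]
  · rintro ⟨_, ⟨y, c, z, rfl, hy, ⟨hc, hc0⟩, hz⟩, rfl⟩
    refine ⟨c 0, (c 0).2, hc0, y.map fun c => (c 0 : Γ), ?_, ?_, ?_⟩
    · intro b hb
      obtain ⟨d, -, rfl⟩ := List.mem_map.1 hb
      exact (d 0).2
    · rw [rowValue_append_cons, wordValue_eq_zero F (x := List.map _ z)
        (by simpa using fun b hb => hz b hb 0), wordValue_append]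
      simp [wordValue]
    · rw [rowValue_append_cons, wordValue_eq_zero F (x := List.map _ z)
        (by simpa using fun b hb => hz b hb 1), wordValue_eq_zero F (x := List.map _ y)
        (by simpa using hy), ← hc]
      simp

theorem isRecognizable_isFirstTerm {S₀ : Finset Γ} (hS₀ : S₀ ⊆ S) :
    IsRecognizable F S {v : Fin 2 → Γ | IsFirstTerm F S S₀ (v 0) (v 1)} := by
  convert isRecognizable_phaseLanguage hF hS hSF (fun c : Fin 2 → S => ∀ i, (c i : Γ) = 0)
    (fun c => (c 0 : Γ) = c 1 ∧ (c 1 : Γ) ∈ S₀ ∧ (c 1 : Γ) ≠ 0) (fun c => (c 1 : Γ) = 0)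
    rfl using 1
  ext v
  constructor
  · rintro ⟨m, b, hb, hb0, w, hw, h0, h1⟩
    obtain ⟨z, hz, rfl, hz0⟩ := exists_map_eq 0 hS hw
    refine ⟨List.replicate m (fun _ => ⟨0, hS.zero_mem⟩) ++ (fun _ => ⟨b, hS₀ hb⟩) :: z,
      ⟨_, _, _, rfl, ?_, ⟨rfl, hb, hb0⟩, fun c hc => hz0 c hc 1 (by simp)⟩, ?_⟩
    · intro c hc i
      rw [List.eq_of_mem_replicate hc]
    funext i
    rw [rowValue_append_cons, List.map_replicate, List.length_replicate,
      wordValue_eq_zero F fun b hb => List.eq_of_mem_replicate hb]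
    fin_cases i
    · simp [h0, wordValue]
    · rw [wordValue_eq_zero F (x := List.map _ z)
        (by simpa using fun b hb => hz0 b hb 1 (by simp))]
      simp [h1]
  · rintro ⟨_, ⟨y, c, z, rfl, hy, ⟨hc, hb, hb0⟩, hz⟩, rfl⟩
    refine ⟨y.length, c 1, hb, hb0, z.map fun c => (c 0 : Γ), ?_, ?_, ?_⟩
    · intro b hb
      obtain ⟨d, -, rfl⟩ := List.mem_map.1 hb
      exact (d 0).2
    · rw [rowValue_append_cons, wordValue_eq_zero F (x := List.map _ y)
        (by simpa using fun b hb => hy b hb 0), ← hc, zero_add, wordValue]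
    · rw [rowValue_append_cons, wordValue_eq_zero F (x := List.map _ z)
        (by simpa using hz), wordValue_eq_zero F (x := List.map _ y)
        (by simpa using fun b hb => hy b hb 1)]
      simp

variable {S₀ : Finset Γ} (hS₀ : IsTransversal F S S₀)

include hS₀

theorem isRecognizable_firstTerm :
    IsRecognizable F S {v : Fin 2 → Γ | firstTerm F S S₀ (v 0) = v 1} := by
  have h1 := isRecognizable_isFirstTerm hF hS hSF hS₀.subset
  have h2 := isRecognizable_const hF hS hSF 0 (0 : Fin 2)
  have h3 := isRecognizable_const hF hS hSF 0 (1 : Fin 2)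
  convert (h1.inter h2.compl).union (h2.inter h3) using 1
  ext v
  by_cases hv : v 0 = 0
  · simp [hv, firstTerm, eq_comm]
  · simp [hv, firstTerm_eq_iff hF hS hSF hS₀ hv]

open FirstOrder FirstOrder.Language

theorem isRecognizable_funMap (n : ℕ) (f : (expansionLanguage S).Functions n) :
    letI := expansion F S S₀
    IsRecognizable F S {v : Fin n ⊕ Unit → Γ |
      Structure.funMap f (v ∘ Sum.inl) = v (Sum.inr ())} := by
  cases f with
  | add => exact isRecognizable_add hF hS hSF (Sum.inl 0) (Sum.inl 1) (Sum.inr ())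
  | endo => exact isRecognizable_endo hF hS hSF (Sum.inl 0) (Sum.inr ())
  | first =>
    exact (isRecognizable_firstTerm hF hS hSF hS₀).preimage_comp
      ![(Sum.inl 0 : Fin 1 ⊕ Unit), Sum.inr ()]

omit hS₀ in
theorem isRecognizable_relMap (n : ℕ) (r : (expansionLanguage S).Relations n) :
    letI := expansion F S S₀
    IsRecognizable F S {v : Fin n → Γ | Structure.RelMap r v} := by
  cases r with
  | last => exact isRecognizable_lastTerm hF hS hSF
  | orbits => exact isRecognizable_orbits hF hS hSF
  | preceq => exact isRecognizable_preceq hF hS hSF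
  | orbit a => exact isRecognizable_orbit hF hS hSF a.2.1

theorem isFAutomatic_of_definable {P : Set Γ} {n : ℕ} {A : Set (Fin n → Γ)}
    (hA : letI := expansion F S S₀; P.Definable (expansionLanguage S) A) :
    IsFAutomatic F A := by
  let := expansion F S S₀
  refine ⟨1, one_pos, S, by rwa [pow_one], ?_⟩
  rw [pow_one]
  exact regularRel_of_isRegular F hS.zero_mem id
    (isRecognizable_of_definable hF hS hSF (isRecognizable_funMap hF hS hSF hS₀)
      (isRecognizable_relMap hF hS hSF) hA)

theorem faPresentable_expansion :
    letI := expansion F S S₀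
    FAPresentable (expansionLanguage S) Γ := by
  let := expansion F S S₀
  -- An FA-presentation wants an alphabet in `Type`, while `S` lives in the universe of `Γ`.
  let e := S.equivFin
  let ν : {x : List (Fin S.card) // x ∈ (⊤ : Language (Fin S.card))} → Γ := fun x =>
    wordValue F (x.1.map fun a => (e.symm a : Γ))
  have key : ∀ {n : ℕ} {X : Set (Fin n → Γ)}, IsRecognizable F S X →
      RegularRel (representatives ν X) := by
    intro n X hX
    refine (congrArg RegularRel (Set.ext fun x => ?_)).mpr
      (regularRel_of_isRegular F hS.zero_mem e.symm hX)
    exact ⟨fun h => h.2, fun h => ⟨fun _ => trivial, h⟩⟩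
  refine ⟨Fin S.card, inferInstance, ⊤, ν, ?_, fun g => ?_, ?_, fun n r => ?_, fun n f => ?_⟩
  · exact isRegular_of_eval (⟨fun s _ => s, (), Set.univ⟩ : DFA _ Unit) fun _ => Iff.rfl
  · obtain ⟨x, hx, rfl⟩ := hS.exists_word g
    lift x to List S using hx
    refine ⟨⟨x.map e, trivial⟩, ?_⟩
    simp [ν, Function.comp_def]
  · exact key (isRecognizable_eq hF hS hSF 0 1)
  · exact key (isRecognizable_relMap hF hS hSF n r)
  · exact key ((isRecognizable_funMap hF hS hSF hS₀ n f).preimage_comp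
      (Sum.elim Fin.castSucc fun _ => Fin.last n))

end PhaseRelations

/-! ### A calculus of definable predicates on coded objects. -/

section Contexts

open FirstOrder

variable {Γ : Type u} [AddCommGroup Γ]

/-- The relations and the graphs of the functions of `Γ_V` are definable without parameters. -/
structure DefinesExpansion (L : FirstOrder.Language.{v, w}) [L.Structure Γ] (F : Module.End ℤ Γ)
    (S S₀ : Finset Γ) : Prop where
  add : (∅ : Set Γ).Definable L {v : Fin 3 → Γ | v 0 = v 1 + v 2}
  endo : (∅ : Set Γ).Definable L {v : Fin 2 → Γ | v 0 = F (v 1)}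
  first : (∅ : Set Γ).Definable L {v : Fin 2 → Γ | v 0 = firstTerm F S S₀ (v 1)}
  last : (∅ : Set Γ).Definable L {v : Fin 2 → Γ | LastTerm F S (v 0) (v 1)}
  preceq : (∅ : Set Γ).Definable L {v : Fin 2 → Γ | Preceq F S (v 0) (v 1)}
  orbit : ∀ a ∈ S, a ≠ 0 → (∅ : Set Γ).Definable L {v : Fin 1 → Γ | v 0 ∈ orbit F a}

theorem definesExpansion (F : Module.End ℤ Γ) (S S₀ : Finset Γ) :
    letI := expansion F S S₀
    DefinesExpansion (expansionLanguage S) F S S₀ := by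
  let := expansion F S S₀
  constructor <;> simp only [Set.empty_definable_iff]
  · exact ⟨(Language.Term.var 0).equal (Language.Term.func (L := expansionLanguage S)
      ExpansionFunctions.add ![Language.Term.var 1, Language.Term.var 2]), by ext v; simp; rfl⟩
  · exact ⟨(Language.Term.var 0).equal (Language.Term.func (L := expansionLanguage S)
      ExpansionFunctions.endo ![Language.Term.var 1]), by ext v; simp; rfl⟩
  · exact ⟨(Language.Term.var 0).equal (Language.Term.func (L := expansionLanguage S)
      ExpansionFunctions.first ![Language.Term.var 1]), by ext v; simp; rfl⟩
  · exact ⟨Language.Relations.formula (L := expansionLanguage S) ExpansionRelations.last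
      Language.Term.var, by ext v; simp; rfl⟩
  · exact ⟨Language.Relations.formula (L := expansionLanguage S) ExpansionRelations.preceq
      Language.Term.var, by ext v; simp; rfl⟩
  · exact fun a ha ha0 => ⟨Language.Relations.formula (L := expansionLanguage S)
      (ExpansionRelations.orbit ⟨a, ha, ha0⟩) Language.Term.var, by ext v; simp; rfl⟩

/-- The elements `a, F a, F² a, …` are distinct and form a definable set, so that they can be used
as codes of the natural numbers. -/
class CodesNat (L : FirstOrder.Language.{v, w}) [L.Structure Γ] (F : Module.End ℤ Γ) (a : Γ) :
    Prop where
  injective : Function.Injective fun i : ℕ => (F ^ i) a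
  definable : (∅ : Set Γ).Definable L {v : Fin 1 → Γ | v 0 ∈ orbit F a}

/-- A type with an encoding by tuples of elements of `Γ`, such that the codes form a definable set.
The natural numbers are encoded by the elements `a, F a, F² a, …`. -/
class Context (L : FirstOrder.Language.{v, w}) [L.Structure Γ] (F : Module.End ℤ Γ) (a : Γ)
    (C : Type*) where
  Index : Type
  finite : Finite Index
  code : C → Index → Γ
  injective : Function.Injective code
  definable : (∅ : Set Γ).Definable L (Set.range code)

attribute [instance] Context.finite

variable (L : FirstOrder.Language.{v, w}) [L.Structure Γ] (F : Module.End ℤ Γ) (a : Γ)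
  {C D E : Type*} [Context L F a C] [Context L F a D] [Context L F a E]

/-- The code of an element of a context. -/
abbrev Context.encode (c : C) : Context.Index L F a C → Γ :=
  Context.code c

instance Context.tuple {ι : Type} [Finite ι] : Context L F a (ι → Γ) where
  Index := ι
  finite := inferInstance
  code := id
  injective := Function.injective_id
  definable := by simp

instance Context.base : Context L F a Γ where
  Index := Unit
  finite := inferInstance
  code x _ := x
  injective _ _ h := congrFun h ()
  definable := by
    convert Set.definable_univ
    exact Set.eq_univ_of_forall fun w => ⟨w (), rfl⟩

instance Context.nat [h : CodesNat L F a] : Context L F a ℕ where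
  Index := Fin 1
  finite := inferInstance
  code i _ := (F ^ i) a
  injective _ _ h' := h.injective (congrFun h' 0)
  definable := by
    convert h.definable using 1
    ext w
    constructor
    · rintro ⟨i, rfl⟩
      exact ⟨i, rfl⟩
    · rintro ⟨i, hi⟩
      exact ⟨i, funext fun j => by rw [Subsingleton.elim j 0, hi]⟩

instance Context.prod : Context L F a (C × D) where
  Index := Context.Index L F a C ⊕ Context.Index L F a D
  finite := inferInstance
  code c := Sum.elim (Context.encode L F a c.1) (Context.encode L F a c.2)
  injective := by
    rintro ⟨c, d⟩ ⟨c', d'⟩ h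
    have h1 := congrArg (· ∘ Sum.inl) h
    have h2 := congrArg (· ∘ Sum.inr) h
    simp only [Sum.elim_comp_inl, Sum.elim_comp_inr] at h1 h2
    rw [Context.injective h1, Context.injective h2]
  definable := by
    convert ((Context.definable (L := L) (F := F) (a := a) (C := C)).preimage_comp
      (Sum.inl : _ → Context.Index L F a C ⊕ Context.Index L F a D)).inter
      ((Context.definable (L := L) (F := F) (a := a) (C := D)).preimage_comp
      (Sum.inr : _ → Context.Index L F a C ⊕ Context.Index L F a D)) using 1
    ext w
    constructor
    · rintro ⟨⟨c, d⟩, rfl⟩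
      exact ⟨⟨c, rfl⟩, d, rfl⟩
    · rintro ⟨⟨c, hc⟩, d, hd⟩
      exact ⟨⟨c, d⟩, by simp only [hc, hd, Sum.elim_comp_inl_inr]⟩

/-- A predicate on a context is definable if the codes of the elements that satisfy it form a
definable set. -/
def DefinablePred (p : C → Prop) : Prop :=
  (∅ : Set Γ).Definable L (Context.encode L F a '' {c | p c})

/-- A map between contexts is definable if its graph is. -/
def DefinableMap (f : C → D) : Prop :=
  DefinablePred L F a fun x : C × D => x.2 = f x.1

/-- A map between contexts that selects some of the coordinates of the codes. -/
def IsSelection (f : C → D) : Prop :=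
  ∃ r : Context.Index L F a D → Context.Index L F a C,
    ∀ c, Context.encode L F a (f c) = Context.encode L F a c ∘ r

variable {L F a}

namespace DefinablePred

variable {p q : C → Prop}

theorem of_code {A : Set (Context.Index L F a C → Γ)} (hA : (∅ : Set Γ).Definable L A)
    (h : ∀ c, p c ↔ Context.encode L F a c ∈ A) : DefinablePred L F a p := by
  refine (congrArg (fun B => (∅ : Set Γ).Definable L B) ?_).mpr
    ((Context.definable (L := L) (F := F) (a := a) (C := C)).inter hA)
  ext w
  constructor
  · rintro ⟨c, hc, rfl⟩
    exact ⟨⟨c, rfl⟩, (h c).1 hc⟩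
  · rintro ⟨⟨c, rfl⟩, hc⟩
    exact ⟨c, (h c).2 hc, rfl⟩

theorem mem_code_image (c : C) :
    Context.encode L F a c ∈ Context.encode L F a '' {c | p c} ↔ p c :=
  Context.injective.mem_set_image

theorem congr (hp : DefinablePred L F a p) (h : ∀ c, q c ↔ p c) : DefinablePred L F a q :=
  of_code hp fun c => (h c).trans (mem_code_image c).symm

theorem and (hp : DefinablePred L F a p) (hq : DefinablePred L F a q) :
    DefinablePred L F a fun c => p c ∧ q c :=
  of_code (Set.Definable.inter hp hq) fun c =>
    (and_congr (mem_code_image c) (mem_code_image c)).symm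

theorem or (hp : DefinablePred L F a p) (hq : DefinablePred L F a q) :
    DefinablePred L F a fun c => p c ∨ q c :=
  of_code (Set.Definable.union hp hq) fun c =>
    (or_congr (mem_code_image c) (mem_code_image c)).symm

theorem not (hp : DefinablePred L F a p) : DefinablePred L F a fun c => ¬ p c :=
  of_code (Set.Definable.compl hp) fun c => (not_congr (mem_code_image c)).symm

theorem imp (hp : DefinablePred L F a p) (hq : DefinablePred L F a q) :
    DefinablePred L F a fun c => p c → q c :=
  (hp.not.or hq).congr fun _ => imp_iff_not_or

theorem iff (hp : DefinablePred L F a p) (hq : DefinablePred L F a q) :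
    DefinablePred L F a fun c => p c ↔ q c :=
  ((hp.imp hq).and (hq.imp hp)).congr fun _ => iff_def

theorem const (b : Prop) : DefinablePred L F a fun _ : C => b := by
  by_cases hb : b
  · exact of_code Set.definable_univ fun _ => iff_of_true hb trivial
  · exact of_code Set.definable_empty fun _ => iff_of_false hb id

theorem all_finite {τ : Type*} [Finite τ] {p : τ → C → Prop}
    (hp : ∀ t, DefinablePred L F a (p t)) : DefinablePred L F a fun c => ∀ t, p t c :=
  of_code (Set.definable_iInter_of_finite hp) fun c => by
    rw [Set.mem_iInter]
    exact forall_congr' fun t => (mem_code_image c).symm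

theorem ex_finite {τ : Type*} [Finite τ] {p : τ → C → Prop}
    (hp : ∀ t, DefinablePred L F a (p t)) : DefinablePred L F a fun c => ∃ t, p t c :=
  of_code (Set.definable_iUnion_of_finite hp) fun c => by
    rw [Set.mem_iUnion]
    exact exists_congr fun t => (mem_code_image c).symm

/-- For a selection the substitution is a mere renaming of variables; for a general definable map,
`DefinablePred.comp` has to quantify over the value. -/
theorem select {f : D → C} (hp : DefinablePred L F a p) (hf : IsSelection L F a f) :
    DefinablePred L F a fun d => p (f d) := by
  obtain ⟨r, hr⟩ := hf
  refine of_code (Set.Definable.preimage_comp r hp) fun d => ?_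
  rw [Set.mem_preimage, ← hr, mem_code_image]

theorem ex {p : C → D → Prop} (hp : DefinablePred L F a fun x : C × D => p x.1 x.2) :
    DefinablePred L F a fun c => ∃ d, p c d := by
  refine of_code (Set.Definable.image_comp hp
    (Sum.inl : Context.Index L F a C → Context.Index L F a C ⊕ Context.Index L F a D))
    fun c => ?_
  constructor
  · rintro ⟨d, hd⟩
    exact ⟨_, ⟨(c, d), hd, rfl⟩, rfl⟩
  · rintro ⟨_, ⟨⟨c', d⟩, hd, rfl⟩, hc⟩
    have : c' = c := Context.injective hc
    exact ⟨d, this ▸ hd⟩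

theorem all {p : C → D → Prop} (hp : DefinablePred L F a fun x : C × D => p x.1 x.2) :
    DefinablePred L F a fun c => ∀ d, p c d :=
  (ex (p := fun c d => ¬ p c d) hp.not).not.congr fun _ => not_exists_not.symm

theorem diagonal : DefinablePred L F a fun x : C × C => x.1 = x.2 := by
  have h : ∀ i : Context.Index L F a C, (∅ : Set Γ).Definable L
      {w : Context.Index L F a C ⊕ Context.Index L F a C → Γ | w (Sum.inl i) = w (Sum.inr i)} :=
    fun i => (Set.DefinableFun.proj L).ofPred_eq (Set.DefinableFun.proj L)
  refine of_code (Set.definable_iInter_of_finite h) fun x => ?_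
  rw [Set.mem_iInter, ← Context.injective.eq_iff (f := Context.encode L F a), funext_iff]
  rfl

end DefinablePred

namespace IsSelection

theorem id : IsSelection L F a (id : C → C) := ⟨_root_.id, fun _ => rfl⟩

theorem fst : IsSelection L F a (Prod.fst : C × D → C) := ⟨Sum.inl, fun _ => rfl⟩

theorem snd : IsSelection L F a (Prod.snd : C × D → D) := ⟨Sum.inr, fun _ => rfl⟩

theorem comp {g : D → E} {f : C → D} (hg : IsSelection L F a g) (hf : IsSelection L F a f) :
    IsSelection L F a fun c => g (f c) := by
  obtain ⟨r, hr⟩ := hg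
  obtain ⟨s, hs⟩ := hf
  exact ⟨s ∘ r, fun c => by rw [hr, hs, Function.comp_assoc]⟩

theorem prodMk {f : C → D} {g : C → E} (hf : IsSelection L F a f) (hg : IsSelection L F a g) :
    IsSelection L F a fun c => (f c, g c) := by
  obtain ⟨r, hr⟩ := hf
  obtain ⟨s, hs⟩ := hg
  refine ⟨Sum.elim r s, fun c => ?_⟩
  change Sum.elim (Context.encode L F a (f c)) (Context.encode L F a (g c)) = _
  rw [hr, hs, Sum.comp_elim]

theorem eval {ι : Type} [Finite ι] (i : ι) : IsSelection L F a fun v : ι → Γ => v i :=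
  ⟨fun _ => i, fun _ => rfl⟩

end IsSelection

theorem IsSelection.definableMap {f : C → D} (hf : IsSelection L F a f) :
    DefinableMap L F a f :=
  DefinablePred.diagonal.select (IsSelection.snd.prodMk (hf.comp IsSelection.fst))

theorem DefinablePred.comp {p : D → Prop} {f : C → D} (hp : DefinablePred L F a p)
    (hf : DefinableMap L F a f) : DefinablePred L F a fun c => p (f c) :=
  (DefinablePred.ex (p := fun c d => d = f c ∧ p d)
    (hf.and (hp.select IsSelection.snd))).congr fun _ => by simp

namespace DefinableMap

theorem comp {g : D → E} {f : C → D} (hg : DefinableMap L F a g) (hf : DefinableMap L F a f) :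
    DefinableMap L F a fun c => g (f c) :=
  (DefinablePred.ex (p := fun (x : C × E) (d : D) => d = f x.1 ∧ x.2 = g d)
    ((hf.select ((IsSelection.fst.comp IsSelection.fst).prodMk IsSelection.snd)).and
      (hg.select (IsSelection.snd.prodMk (IsSelection.snd.comp IsSelection.fst))))).congr
    fun _ => by simp

theorem prodMk {f : C → D} {g : C → E} (hf : DefinableMap L F a f) (hg : DefinableMap L F a g) :
    DefinableMap L F a fun c => (f c, g c) :=
  ((hf.select (IsSelection.fst.prodMk (IsSelection.fst.comp IsSelection.snd))).and
    (hg.select (IsSelection.fst.prodMk (IsSelection.snd.comp IsSelection.snd)))).congr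
    fun _ => Prod.ext_iff

theorem pi {ι : Type} [Finite ι] {f : C → ι → Γ} (hf : ∀ i, DefinableMap L F a fun c => f c i) :
    DefinableMap L F a f :=
  (DefinablePred.all_finite fun i =>
    (hf i).select (IsSelection.fst.prodMk ((IsSelection.eval i).comp IsSelection.snd))).congr
    fun _ => funext_iff

theorem fst : DefinableMap L F a (Prod.fst : C × D → C) := IsSelection.fst.definableMap

theorem snd : DefinableMap L F a (Prod.snd : C × D → D) := IsSelection.snd.definableMap

theorem eval {ι : Type} [Finite ι] (i : ι) {f : C → ι → Γ} (hf : DefinableMap L F a f) :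
    DefinableMap L F a fun c => f c i :=
  (IsSelection.eval i).definableMap.comp hf

end DefinableMap

theorem DefinablePred.comp₂ {p : D → E → Prop} {f : C → D} {g : C → E}
    (hp : DefinablePred L F a fun x : D × E => p x.1 x.2) (hf : DefinableMap L F a f)
    (hg : DefinableMap L F a g) : DefinablePred L F a fun c => p (f c) (g c) :=
  hp.comp (hf.prodMk hg)

theorem DefinablePred.eq {f g : C → D} (hf : DefinableMap L F a f) (hg : DefinableMap L F a g) :
    DefinablePred L F a fun c => f c = g c :=
  diagonal.comp₂ (p := fun x y => x = y) hf hg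

theorem DefinablePred.mem {n : ℕ} {A : Set (Fin n → Γ)} (hA : (∅ : Set Γ).Definable L A)
    {f : C → Fin n → Γ} (hf : ∀ i, DefinableMap L F a fun c => f c i) :
    DefinablePred L F a fun c => f c ∈ A :=
  (of_code (p := fun v : Fin n → Γ => v ∈ A) (L := L) (F := F) (a := a) hA
    fun _ => Iff.rfl).comp (DefinableMap.pi hf)

theorem DefinablePred.definable {ι : Type} [Finite ι] {p : (ι → Γ) → Prop}
    (hp : DefinablePred L F a p) : (∅ : Set Γ).Definable L {v | p v} :=
  (congrArg (fun B => (∅ : Set Γ).Definable L B) (Set.image_id _)).mp hp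

end Contexts

/-! ### Coding finite sets of natural numbers with gaps. -/

section Codes

variable {Γ : Type u} [AddCommGroup Γ] (F : Module.End ℤ Γ) (S : Finset Γ)

/-- The sum of `F^i t` over `i ∈ X`. -/
def sumAt (X : Finset ℕ) (t : Γ) : Γ := ∑ i ∈ X, (F ^ i) t

/-- `z` is represented by a word over `S` of length at most `i`. -/
def IsShort (i : ℕ) (z : Γ) : Prop :=
  ∃ f : ℕ → Γ, (∀ j, f j ∈ S) ∧ z = ∑ j ∈ Finset.range i, (F ^ j) (f j)

/-- `F² g` is the sum of a word of length at most `i`, of `F^(i+2) s`, and of a multiple of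
`F^(i+3)`. -/
def IsTruncation (s g : Γ) (i : ℕ) (z : Γ) : Prop :=
  IsShort F S i z ∧ ∃ k, F (F g) = z + F (F ((F ^ i) s)) + F (F (F ((F ^ i) k)))

/-- Any two elements of `X` have distance at least three. -/
def IsGapped (X : Finset ℕ) : Prop := ∀ i ∈ X, ∀ j ∈ X, i < j → i + 3 ≤ j

variable {F S}

theorem sumAt_zero (X : Finset ℕ) : sumAt F X 0 = 0 := by simp [sumAt]

theorem sumAt_add (X : Finset ℕ) (s t : Γ) : sumAt F X (s + t) = sumAt F X s + sumAt F X t := by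
  simp [sumAt, Finset.sum_add_distrib]

theorem endo_pow_apply (i : ℕ) (x : Γ) : F ((F ^ i) x) = (F ^ i) (F x) := by
  rw [← Module.End.mul_apply, ← pow_succ', pow_succ, Module.End.mul_apply]

theorem map_sumAt (X : Finset ℕ) (t : Γ) : F (sumAt F X t) = sumAt F X (F t) := by
  simp only [sumAt, map_sum, endo_pow_apply]

theorem sumAt_insert {X : Finset ℕ} {i : ℕ} (hi : i ∉ X) (t : Γ) :
    sumAt F (insert i X) t = sumAt F X t + (F ^ i) t := by
  rw [sumAt, Finset.sum_insert hi, add_comm, sumAt]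

theorem sumAt_eq_of_max {X : Finset ℕ} {i : ℕ} (hi : i ∈ X) (hX : ∀ j ∈ X, j ≤ i) (t : Γ) :
    sumAt F X t = sumAt F (X.filter (· < i)) t + (F ^ i) t := by
  rw [← sumAt_insert (by simp)]
  congr 1
  ext j
  simp only [Finset.mem_insert, Finset.mem_filter]
  constructor
  · exact fun hj => (hX j hj).eq_or_lt.imp_right fun h => ⟨hj, h⟩
  · rintro (rfl | hj)
    exacts [hi, hj.1]

theorem IsGapped.filter {X : Finset ℕ} (hX : IsGapped X) (p : ℕ → Prop) [DecidablePred p] :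
    IsGapped (X.filter p) :=
  fun i hi j hj => hX i (Finset.mem_of_mem_filter i hi) j (Finset.mem_of_mem_filter j hj)

theorem IsGapped.insert {X : Finset ℕ} (hX : IsGapped X) {i : ℕ} (hi : ∀ j ∈ X, j + 3 ≤ i) :
    IsGapped (insert i X) := by
  intro j hj k hk hjk
  rcases Finset.mem_insert.1 hj with h | h <;> rcases Finset.mem_insert.1 hk with h' | h'
  · omega
  · have := hi k h'
    omega
  · have := hi j h
    omega
  · exact hX j h k h' hjk

/-- Splitting a sum at the positions `i`, `i + 1`, `i + 2`. -/
theorem sumAt_split (X : Finset ℕ) (i : ℕ) (t : Γ) : ∃ k,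
    sumAt F X t = sumAt F (X.filter (· < i)) t + (F ^ i) ((if i ∈ X then t else 0) +
      F ((if i + 1 ∈ X then t else 0) + F ((if i + 2 ∈ X then t else 0) + F k))) := by
  have key : ∀ i, ∑ j ∈ X with ¬ j < i, (F ^ j) t =
      (F ^ i) (if i ∈ X then t else 0) + ∑ j ∈ X with ¬ j < i + 1, (F ^ j) t := by
    intro i
    by_cases hi : i ∈ X
    · have : X.filter (¬ · < i) = insert i (X.filter (¬ · < i + 1)) := by
        ext j
        simp only [Finset.mem_filter, Finset.mem_insert]
        constructor
        · rintro ⟨h1, h2⟩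
          by_cases hj : j = i
          · exact Or.inl hj
          · exact Or.inr ⟨h1, by omega⟩
        · rintro (rfl | ⟨h1, h2⟩)
          · exact ⟨hi, by omega⟩
          · exact ⟨h1, by omega⟩
      rw [this, Finset.sum_insert (by simp), if_pos hi]
    · rw [if_neg hi, map_zero, zero_add]
      congr 1
      ext j
      simp only [Finset.mem_filter]
      refine and_congr_right fun hj => ?_
      have : j ≠ i := fun h => hi (h ▸ hj)
      omega
  have tail : ∑ j ∈ X with ¬ j < i + 3, (F ^ j) t =
      (F ^ (i + 3)) (∑ j ∈ X with ¬ j < i + 3, (F ^ (j - (i + 3))) t) := by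
    rw [map_sum]
    refine Finset.sum_congr rfl fun j hj => ?_
    rw [← Module.End.mul_apply, ← pow_add, Nat.add_sub_cancel' (by simp at hj; omega)]
  refine ⟨∑ j ∈ X with ¬ j < i + 3, (F ^ (j - (i + 3))) t, ?_⟩
  rw [sumAt, ← Finset.sum_filter_add_sum_filter_not X (· < i), key, key, key, tail]
  simp only [map_add, pow_succ, Module.End.mul_apply, sumAt]

theorem isShort_sumAt (h0 : (0 : Γ) ∈ S) {s : Γ} (hs : s ∈ S) (X : Finset ℕ) (i : ℕ) :
    IsShort F S i (sumAt F (X.filter (· < i)) s) := by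
  refine ⟨fun j => if j ∈ X then s else 0, fun j => by dsimp only; split_ifs <;> assumption, ?_⟩
  have : ∀ j, (F ^ j) (if j ∈ X then s else 0) = if j ∈ X then (F ^ j) s else 0 := fun j => by
    split_ifs <;> simp
  simp only [this, sumAt, Finset.sum_ite, Finset.sum_const_zero, add_zero]
  congr 1
  ext j
  simp [and_comm]

variable (hF : Function.Injective F) (hS : IsSpanning F S)
  (hSF : ∀ a ∈ S, ∀ x : Γ, a = F x → a = 0)

include hF

theorem pow_injective (i : ℕ) : Function.Injective (F ^ i) := by
  rw [Module.End.coe_pow]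
  exact hF.iterate i

include hS hSF

/-- Subtract the two words digit by digit. By `mem_of_add_add_eq` the carry is a letter at every
position, and `c` is the carry that leaves the position `i`. -/
theorem IsShort.mem_of_sub_eq {i : ℕ} {z z' c : Γ} (hz : IsShort F S i z)
    (hz' : IsShort F S i z') (h : z - z' = (F ^ i) c) : c ∈ S := by
  have key : ∀ i, ∀ d ∈ S, ∀ f f' : ℕ → Γ, (∀ j, f j ∈ S) → (∀ j, f' j ∈ S) →
      d + (∑ j ∈ Finset.range i, (F ^ j) (f j) - ∑ j ∈ Finset.range i, (F ^ j) (f' j)) =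
        (F ^ i) c → c ∈ S := by
    intro i
    induction i with
    | zero =>
      intro d hd f f' _ _ h
      have : d = c := by simpa using h
      exact this ▸ hd
    | succ i ih =>
      intro d hd f f' hf hf' h
      have hsum : ∀ f : ℕ → Γ, ∑ j ∈ Finset.range (i + 1), (F ^ j) (f j) =
          F (∑ j ∈ Finset.range i, (F ^ j) (f (j + 1))) + f 0 := fun f => by
        rw [Finset.sum_range_succ', map_sum, pow_zero, Module.End.one_apply]
        simp only [pow_succ', Module.End.mul_apply]
      rw [hsum, hsum, pow_succ', Module.End.mul_apply] at h
      have h' : d + f 0 + -f' 0 = F ((F ^ i) c -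
          (∑ j ∈ Finset.range i, (F ^ j) (f (j + 1)) -
            ∑ j ∈ Finset.range i, (F ^ j) (f' (j + 1)))) := by
        rw [map_sub, ← h, map_sub]
        abel
      refine ih _ (mem_of_add_add_eq hF hS hSF hd (hf 0) (hS.neg_mem _ (hf' 0)) h') _ _
        (fun j => hf (j + 1)) (fun j => hf' (j + 1)) (by abel)
  obtain ⟨f, hf, rfl⟩ := hz
  obtain ⟨f', hf', rfl⟩ := hz'
  exact key i 0 hS.zero_mem f f' hf hf' (by rwa [zero_add])

/-- For a gapped set `X` and a nonzero `s ∈ S`, the digit at the position `i + 2` can be read off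
from `∑ F^j s` over `j ∈ X`. -/
theorem truncation_iff_aux {s : Γ} (hs : s ∈ S) (hs0 : s ≠ 0) {X : Finset ℕ}
    (hX : IsGapped X) (i : ℕ) (z : Γ) :
    (IsShort F S i z ∧ ∃ k, sumAt F X s = z + (F ^ i) (F (F (s + F k)))) ↔
      i + 2 ∈ X ∧ z = sumAt F (X.filter (· < i + 2)) s := by
  obtain ⟨k', hk'⟩ := sumAt_split (F := F) X i s
  have hshort : IsShort F S i (sumAt F (X.filter (· < i)) s) :=
    isShort_sumAt hS.zero_mem hs X i
  have hfilter : i + 2 ∈ X → X.filter (· < i + 2) = X.filter (· < i) := by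
    intro hi
    ext j
    simp only [Finset.mem_filter]
    refine and_congr_right fun hj => ⟨fun h => ?_, fun h => by omega⟩
    have := hX j hj _ hi h
    omega
  have hnot : i + 2 ∈ X → i ∉ X ∧ i + 1 ∉ X := fun hi =>
    ⟨fun h => by have := hX _ h _ hi (by omega); omega,
      fun h => by have := hX _ h _ hi (by omega); omega⟩
  constructor
  · rintro ⟨hz, k, hk⟩
    -- `c` is the carry between `z` and the true initial segment of the sum; it is a letter. The
    -- gaps allow at most one digit among the positions `i`, `i + 1`, `i + 2`, and each case is
    -- decided by the fact that the only letter in the image of `F` is zero.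
    obtain ⟨c, hc⟩ : ∃ c, c = ((if i ∈ X then s else 0) + F ((if i + 1 ∈ X then s else 0) +
        F ((if i + 2 ∈ X then s else 0) + F k'))) - F (F (s + F k)) := ⟨_, rfl⟩
    have hzc : z - sumAt F (X.filter (· < i)) s = (F ^ i) c := by
      rw [hc, map_sub, sub_eq_sub_iff_add_eq_add, ← hk, hk', add_comm]
    have hcS : c ∈ S := hz.mem_of_sub_eq hF hS hSF hshort hzc
    have hsF : ∀ x, s ≠ F x := fun x hx => hs0 (hSF s hs x hx)
    by_cases h2 : i + 2 ∈ X
    · obtain ⟨h0, h1⟩ := hnot h2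
      refine ⟨h2, ?_⟩
      rw [if_neg h0, if_neg h1, if_pos h2] at hc
      -- The digit at `i + 2` is present, so the positions `i` and `i + 1` are free and `c` lies in
      -- the image of `F`.
      have hc0 : c = 0 := hSF c hcS (F (s + F k') - F (s + F k)) (by
        rw [hc, map_sub, zero_add, zero_add])
      rw [hc0, map_zero, sub_eq_zero] at hzc
      rw [hzc, hfilter h2]
    · exfalso
      rw [if_neg h2, zero_add] at hc
      by_cases h0 : i ∈ X
      · have h1 : i + 1 ∉ X := fun h1 => by have := hX _ h0 _ h1 (by omega); omega
        rw [if_pos h0, if_neg h1, zero_add] at hc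
        -- The digit `s` sits at position `i`, so `c - s` is `F` of this element, which is therefore
        -- a letter in the image of `F`, hence zero. Then `s` itself lies in that image.
        have hd : F (F k' - (s + F k)) ∈ S :=
          mem_of_add_add_eq hF hS hSF hcS (hS.neg_mem _ hs) hS.zero_mem (by
            rw [hc]
            simp only [map_add, map_sub]
            abel)
        have := hF ((hSF _ hd _ rfl).trans (map_zero F).symm)
        refine hsF (k' - k) ?_
        rw [map_sub, eq_sub_iff_add_eq]
        exact (sub_eq_zero.1 this).symm
      · rw [if_neg h0, zero_add] at hc
        by_cases h1 : i + 1 ∈ X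
        · rw [if_pos h1] at hc
          have hc' : c = F (s + F (F k') - F (s + F k)) := by rw [hc, map_sub]
          rw [hSF c hcS _ hc'] at hc'
          have := hF (hc'.symm.trans (map_zero F).symm)
          refine hsF ((s + F k) - F k') ?_
          rw [map_sub, eq_sub_iff_add_eq]
          exact sub_eq_zero.1 this
        · rw [if_neg h1, zero_add] at hc
          have hc' : c = F (F (F k' - (s + F k))) := by rw [hc, map_sub, map_sub]
          rw [hSF c hcS _ hc'] at hc'
          have := hF ((hF (hc'.symm.trans (map_zero F).symm)).trans (map_zero F).symm)
          refine hsF (k' - k) ?_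
          rw [map_sub, eq_sub_iff_add_eq]
          exact (sub_eq_zero.1 this).symm
  · rintro ⟨h2, rfl⟩
    obtain ⟨h0, h1⟩ := hnot h2
    rw [hfilter h2]
    refine ⟨hshort, k', ?_⟩
    rw [hk', if_neg h0, if_neg h1, if_pos h2, zero_add, zero_add]

/-- The two applications of `F` make room: shifting `X` by two leaves two free positions above a
word of length `i` even if `i` is `0` or `1`. -/
theorem isTruncation_iff {s : Γ} (hs : s ∈ S) (hs0 : s ≠ 0) {X : Finset ℕ}
    (hX : IsGapped X) (i : ℕ) (z : Γ) : IsTruncation F S s (sumAt F X s) i z ↔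
      i ∈ X ∧ z = F (F (sumAt F (X.filter (· < i)) s)) := by
  have hshift : ∀ X : Finset ℕ, F (F (sumAt F X s)) = sumAt F (X.map (addRightEmbedding 2)) s := by
    intro X
    simp [sumAt, pow_succ, endo_pow_apply]
  have hY : IsGapped (X.map (addRightEmbedding 2)) := by
    intro i hi j hj hij
    obtain ⟨i', hi', rfl⟩ := Finset.mem_map.1 hi
    obtain ⟨j', hj', rfl⟩ := Finset.mem_map.1 hj
    simp only [addRightEmbedding_apply] at hij ⊢
    have := hX i' hi' j' hj' (by omega)
    omega
  convert truncation_iff_aux hF hS hSF hs hs0 hY i z using 1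
  · rw [IsTruncation, hshift]
    simp only [endo_pow_apply, map_add, add_assoc]
  · rw [hshift, Finset.filter_map]
    simp

theorem eq_of_sumAt_eq {s : Γ} (hs : s ∈ S) (hs0 : s ≠ 0) {X Y : Finset ℕ} (hX : IsGapped X)
    (hY : IsGapped Y) (h : sumAt F X s = sumAt F Y s) : X = Y := by
  ext i
  have h1 := fun z => isTruncation_iff hF hS hSF hs hs0 hX i z
  have h2 := fun z => isTruncation_iff hF hS hSF hs hs0 hY i z
  rw [h] at h1
  exact ⟨fun hi => ((h2 _).1 ((h1 _).2 ⟨hi, rfl⟩)).1, fun hi => ((h1 _).1 ((h2 _).2 ⟨hi, rfl⟩)).1⟩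

/-- A characterization of the sums `∑ F^i s` over gapped sets that avoids quantification over
sets. -/
theorem exists_gapped_iff {s : Γ} (hs : s ∈ S) (hs0 : s ≠ 0) (g : Γ) :
    (∃ X, IsGapped X ∧ g = sumAt F X s) ↔ g = 0 ∨
      (∃ x : ℕ × Γ, IsTruncation F S s g x.1 x.2 ∧ F (F g) = x.2 + F (F ((F ^ x.1) s))) ∧
      ∀ x : ℕ × Γ, IsTruncation F S s g x.1 x.2 → x.2 = 0 ∨
        ∃ y : ℕ × Γ, IsTruncation F S s g y.1 y.2 ∧ y.1 + 3 ≤ x.1 ∧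
          x.2 = y.2 + F (F ((F ^ y.1) s)) := by
  constructor
  · rintro ⟨X, hX, rfl⟩
    rcases X.eq_empty_or_nonempty with rfl | hne
    · exact Or.inl rfl
    -- The largest element of `X` yields the full sum, and below any element of `X` the next smaller
    -- one yields its truncation.
    have htr := fun i z => isTruncation_iff hF hS hSF hs hs0 hX i z
    refine Or.inr ⟨⟨(X.max' hne, F (F (sumAt F (X.filter (· < X.max' hne)) s))), ?_, ?_⟩, ?_⟩
    · exact (htr _ _).2 ⟨X.max'_mem hne, rfl⟩
    · rw [sumAt_eq_of_max (X.max'_mem hne) (fun j hj => X.le_max' j hj), map_add, map_add]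
    · rintro ⟨i, z⟩ hz
      obtain ⟨hi, hz⟩ := (htr _ _).1 hz
      simp only at hi hz ⊢
      rcases (X.filter (· < i)).eq_empty_or_nonempty with he | hne
      · left
        simp [hz, he, sumAt]
      · right
        have hm := (X.filter (· < i)).max'_mem hne
        obtain ⟨hmX, hmi⟩ := Finset.mem_filter.1 hm
        refine ⟨((X.filter (· < i)).max' hne,
          F (F (sumAt F (X.filter (· < (X.filter (· < i)).max' hne)) s))),
          (htr _ _).2 ⟨hmX, rfl⟩, hX _ hmX _ hi hmi, ?_⟩
        have he : (X.filter (· < i)).filter (· < (X.filter (· < i)).max' hne) =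
            X.filter (· < (X.filter (· < i)).max' hne) := by
          rw [Finset.filter_filter]
          exact Finset.filter_congr fun j _ => ⟨fun h => h.2, fun h => ⟨h.trans hmi, h⟩⟩
        rw [hz, sumAt_eq_of_max hm fun j hj => Finset.le_max' _ j hj, map_add, map_add, he]
  · rintro (rfl | ⟨⟨⟨i, z⟩, hz, hg⟩, hall⟩)
    · exact ⟨∅, by simp [IsGapped], rfl⟩
    -- Descent on the position: a nonzero truncation arises from one at least three places lower by
    -- adding a single digit, so the set is rebuilt from below.
    · have key : ∀ i z, IsTruncation F S s g i z →
          ∃ X, IsGapped X ∧ (∀ j ∈ X, j + 3 ≤ i) ∧ z = F (F (sumAt F X s)) := by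
        intro i
        induction i using Nat.strong_induction_on with
        | _ i ih =>
          intro z hz
          rcases hall (i, z) hz with h0 | ⟨⟨j, y⟩, hy, hji, hzy⟩
          · exact ⟨∅, by simp [IsGapped], by simp, by simpa [sumAt] using h0⟩
          · simp only at hy hji hzy
            obtain ⟨X, hX, hXj, rfl⟩ := ih j (by omega) y hy
            refine ⟨insert j X, hX.insert hXj, fun k hk => ?_, ?_⟩
            · rcases Finset.mem_insert.1 hk with rfl | hk
              · exact hji
              · have := hXj k hk
                omega
            · rw [sumAt_insert fun h => by have := hXj j h; omega, map_add, map_add, hzy]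
      obtain ⟨X, hX, hXi, rfl⟩ := key i z hz
      refine ⟨insert i X, hX.insert hXi, hF (hF ?_)⟩
      rw [sumAt_insert fun h => by have := hXi i h; omega, map_add, map_add, hg]

end Codes

/-! ### Length and divisibility in terms of `R`, `V_F` and `⪯`. -/

section Positions

variable {Γ : Type u} [AddCommGroup Γ] {F : Module.End ℤ Γ} {S S₀ : Finset Γ}

theorem wordValue_map_range (f : ℕ → Γ) (i : ℕ) :
    wordValue F ((List.range i).map f) = ∑ j ∈ Finset.range i, (F ^ j) (f j) := by
  induction i with
  | zero => rfl
  | succ i ih =>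
    rw [List.range_succ, List.map_append, wordValue_append, ih, Finset.sum_range_succ]
    simp [wordValue]

theorem isShort_wordValue (h0 : (0 : Γ) ∈ S) {x : List Γ} (hx : ∀ b ∈ x, b ∈ S) {i : ℕ}
    (hi : x.length ≤ i) : IsShort F S i (wordValue F x) := by
  induction x generalizing i with
  | nil => exact ⟨fun _ => 0, fun _ => h0, by simp [wordValue]⟩
  | cons b x ih =>
    obtain ⟨i, rfl⟩ := Nat.exists_eq_add_of_lt (lt_of_lt_of_le (Nat.succ_pos _) hi)
    rw [zero_add] at hi ⊢
    obtain ⟨f, hf, hfx⟩ := ih (fun c hc => hx c (List.mem_cons_of_mem _ hc))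
      (i := i) (by simpa using hi)
    refine ⟨fun j => Nat.casesOn j b f, fun j => ?_, ?_⟩
    · cases j with
      | zero => exact hx b List.mem_cons_self
      | succ j => exact hf j
    · rw [wordValue, hfx, Finset.sum_range_succ', map_sum, add_comm]
      simp [pow_succ']

theorem IsShort.exists_word {i : ℕ} {z : Γ} (hz : IsShort F S i z) : z = 0 ∨
    ∃ b ∈ S, b ≠ 0 ∧ ∃ x : List Γ, (∀ c ∈ x, c ∈ S) ∧ z = wordValue F (x ++ [b]) ∧
      x.length < i := by
  obtain ⟨f, hf, rfl⟩ := hz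
  induction i with
  | zero => exact Or.inl rfl
  | succ i ih =>
    by_cases hfi : f i = 0
    · rw [Finset.sum_range_succ, hfi, map_zero, add_zero]
      refine ih.imp_right ?_
      rintro ⟨b, hb, hb0, x, hx, h, hi⟩
      exact ⟨b, hb, hb0, x, hx, h, hi.trans (Nat.lt_succ_self i)⟩
    · refine Or.inr ⟨f i, hf i, hfi, (List.range i).map f, ?_, ?_, by simp⟩
      · intro c hc
        obtain ⟨j, -, rfl⟩ := List.mem_map.1 hc
        exact hf j
      · rw [← wordValue_map_range, List.range_succ, List.map_append]
        rfl

variable (hF : Function.Injective F) (hS : IsSpanning F S)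
  (hSF : ∀ a ∈ S, ∀ x : Γ, a = F x → a = 0) (hS₀ : IsTransversal F S S₀)

include hF hSF

theorem preceq_pow_iff {b c : Γ} (hb : b ∈ S) (hb0 : b ≠ 0) (hc : c ∈ S) (hc0 : c ≠ 0)
    {i j : ℕ} : Preceq F S ((F ^ i) b) ((F ^ j) c) ↔ i ≤ j := by
  constructor
  · rintro (⟨b', hb', hb0', c', hc', hc0', i', j', hij, hi, hj⟩ | ⟨-, h⟩)
    · exact (le_of_pow_eq_pow hSF hF hb' hb0' hi).trans
        (hij.trans (le_of_pow_eq_pow hSF hF hc hc0 hj.symm))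
    · exact absurd (pow_injective hF j (h.trans (map_zero _).symm)) hc0
  · exact fun h => Or.inl ⟨b, hb, hb0, c, hc, hc0, i, j, h, rfl, rfl⟩

theorem pow_left_injective {b : Γ} (hb : b ∈ S) (hb0 : b ≠ 0) :
    Function.Injective fun i : ℕ => (F ^ i) b := fun _ _ h =>
  le_antisymm (le_of_pow_eq_pow hSF hF hb hb0 h) (le_of_pow_eq_pow hSF hF hb hb0 h.symm)

/-- Only this translation uses `R`: being short means having a representation whose last nonzero
letter stands strictly before `i`. -/
theorem isShort_iff (h0 : (0 : Γ) ∈ S) {a : Γ} (ha : a ∈ S) (ha0 : a ≠ 0) (i : ℕ) (z : Γ) :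
    IsShort F S i z ↔ z = 0 ∨ ∃ x, LastTerm F S z x ∧ Preceq F S x ((F ^ i) a) ∧
      ¬ Preceq F S ((F ^ i) a) x := by
  constructor
  · intro hz
    refine hz.exists_word.imp_right ?_
    rintro ⟨b, hb, hb0, x, hx, rfl, hi⟩
    exact ⟨_, Or.inl ⟨b, hb, hb0, x, hx, rfl, rfl⟩,
      (preceq_pow_iff hF hSF hb hb0 ha ha0).2 hi.le,
      fun h => hi.not_ge ((preceq_pow_iff hF hSF ha ha0 hb hb0).1 h)⟩
  · have hzero : IsShort F S i 0 := ⟨fun _ => 0, fun _ => h0, by simp⟩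
    rintro (rfl | ⟨x, ⟨b, hb, hb0, w, hw, rfl, rfl⟩ | ⟨rfl, -⟩, -, h⟩)
    · exact hzero
    · rw [preceq_pow_iff hF hSF ha ha0 hb hb0, not_le] at h
      refine isShort_wordValue h0 (fun c hc => ?_) (by simpa using h)
      rcases List.mem_append.1 hc with hc | hc
      · exact hw c hc
      · rwa [List.mem_singleton.1 hc]
    · exact hzero

include hS hS₀ in
theorem exists_eq_pow_iff {a : Γ} (ha : a ∈ S) (ha0 : a ≠ 0) (i : ℕ) (x : Γ) :
    (∃ k, x = (F ^ i) k) ↔ Preceq F S ((F ^ i) a) (firstTerm F S S₀ x) := by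
  by_cases hx : x = 0
  -- Zero is divisible by every power. This agrees with `V_F(0) = 0` being the top element of `⪯`.
  · refine iff_of_true ⟨0, by simp [hx]⟩ (Or.inr ⟨Or.inl ⟨a, ha, ha0, i, rfl⟩, ?_⟩)
    simp [firstTerm, hx]
  · obtain ⟨y, hy⟩ := exists_isFirstTerm hS hSF hS₀ hx
    rw [(firstTerm_eq_iff hF hS hSF hS₀ hx).2 hy]
    constructor
    · rintro ⟨k, rfl⟩
      have hk : k ≠ 0 := fun h => hx (by rw [h, map_zero])
      obtain ⟨y', m, b, hb, hb0, w, hw, hkw, hy'⟩ := exists_isFirstTerm hS hSF hS₀ hk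
      have : y = (F ^ (i + m)) b := by
        refine hy.unique hF hSF hS₀ ⟨i + m, b, hb, hb0, w, hw, ?_, rfl⟩
        rw [hkw, ← Module.End.mul_apply, ← pow_add]
      rw [this, preceq_pow_iff hF hSF ha ha0 (hS₀.subset hb) hb0]
      exact Nat.le_add_right i m
    · obtain ⟨m, b, hb, hb0, w, hw, rfl, rfl⟩ := hy
      rw [preceq_pow_iff hF hSF ha ha0 (hS₀.subset hb) hb0]
      intro h
      exact ⟨(F ^ (m - i)) (wordValue F (b :: w)), by
        rw [← Module.End.mul_apply, ← pow_add, Nat.add_sub_cancel' h]⟩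

end Positions

/-! ### The coding is definable in the expansion. -/

section Definability

open FirstOrder

variable {Γ : Type u} [AddCommGroup Γ] {F : Module.End ℤ Γ} {S S₀ : Finset Γ}
  {L : FirstOrder.Language.{v, w}} [L.Structure Γ] {a : Γ}
  {C : Type*} [Context L F a C]

variable (hD : DefinesExpansion L F S S₀)

include hD

theorem DefinableMap.add {f g : C → Γ} (hf : DefinableMap L F a f)
    (hg : DefinableMap L F a g) : DefinableMap L F a fun c => f c + g c :=
  DefinablePred.mem hD.add (f := fun x : C × Γ => ![x.2, f x.1, g x.1]) (by
    intro i
    fin_cases i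
    exacts [.snd, hf.comp .fst, hg.comp .fst])

theorem DefinableMap.endo {f : C → Γ} (hf : DefinableMap L F a f) :
    DefinableMap L F a fun c => F (f c) :=
  DefinablePred.mem hD.endo (f := fun x : C × Γ => ![x.2, f x.1]) (by
    intro i
    fin_cases i
    exacts [.snd, hf.comp .fst])

theorem DefinableMap.firstTerm {f : C → Γ} (hf : DefinableMap L F a f) :
    DefinableMap L F a fun c => FAutomata.firstTerm F S S₀ (f c) :=
  DefinablePred.mem hD.first (f := fun x : C × Γ => ![x.2, f x.1]) (by
    intro i
    fin_cases i
    exacts [.snd, hf.comp .fst])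

theorem DefinablePred.lastTerm {f g : C → Γ} (hf : DefinableMap L F a f)
    (hg : DefinableMap L F a g) : DefinablePred L F a fun c => LastTerm F S (f c) (g c) :=
  DefinablePred.mem hD.last (f := fun c => ![f c, g c]) (by
    intro i
    fin_cases i
    exacts [hf, hg])

theorem DefinablePred.preceq {f g : C → Γ} (hf : DefinableMap L F a f)
    (hg : DefinableMap L F a g) : DefinablePred L F a fun c => Preceq F S (f c) (g c) :=
  DefinablePred.mem hD.preceq (f := fun c => ![f c, g c]) (by
    intro i
    fin_cases i
    exacts [hf, hg])

theorem DefinablePred.orbit {s : Γ} (hs : s ∈ S) (hs0 : s ≠ 0) {f : C → Γ}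
    (hf : DefinableMap L F a f) : DefinablePred L F a fun c => f c ∈ orbit F s :=
  DefinablePred.mem (hD.orbit s hs hs0) (f := fun c => ![f c]) (by
    intro i
    fin_cases i
    exact hf)

theorem DefinableMap.zero : DefinableMap L F a fun _ : C => (0 : Γ) :=
  (DefinablePred.eq (DefinableMap.snd.add hD .snd) .snd).congr fun x => by simp

theorem DefinableMap.sum {τ : Type*} (s : Finset τ) {f : τ → C → Γ}
    (hf : ∀ t, DefinableMap L F a (f t)) : DefinableMap L F a fun c => ∑ t ∈ s, f t c := by
  classical
  induction s using Finset.induction_on with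
  | empty => exact .zero hD
  | insert t s ht ih =>
    simp only [Finset.sum_insert ht]
    exact (hf t).add hD ih

theorem DefinableMap.pow_const {f : C → Γ} (hf : DefinableMap L F a f) (n : ℕ) :
    DefinableMap L F a fun c => (F ^ n) (f c) := by
  induction n with
  | zero => exact hf
  | succ n ih =>
    simp only [pow_succ', Module.End.mul_apply]
    exact ih.endo hD

variable [CodesNat L F a]

omit hD in
theorem DefinableMap.pow_base {f : C → ℕ} (hf : DefinableMap L F a f) :
    DefinableMap L F a fun c => (F ^ f c) a := by
  have h : DefinableMap L F a fun i : ℕ => (F ^ i) a := by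
    refine DefinablePred.of_code (A := {w : Fin 1 ⊕ Unit → Γ | w (Sum.inr ()) = w (Sum.inl 0)})
      ?_ fun _ => Iff.rfl
    exact (Set.DefinableFun.proj L).ofPred_eq (Set.DefinableFun.proj L)
  exact h.comp hf

variable (hF : Function.Injective F) (hS : IsSpanning F S)
  (hSF : ∀ a ∈ S, ∀ x : Γ, a = F x → a = 0) (hS₀ : IsTransversal F S S₀)
  (ha : a ∈ S) (ha0 : a ≠ 0)

include hF hSF ha ha0

theorem DefinablePred.le {f g : C → ℕ} (hf : DefinableMap L F a f)
    (hg : DefinableMap L F a g) : DefinablePred L F a fun c => f c ≤ g c :=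
  (DefinablePred.preceq hD hf.pow_base hg.pow_base).congr fun _ =>
    (preceq_pow_iff hF hSF ha ha0 ha ha0).symm

theorem DefinablePred.eq_zero {f : C → ℕ} (hf : DefinableMap L F a f) :
    DefinablePred L F a fun c => f c = 0 :=
  (DefinablePred.all (p := fun c (j : ℕ) => f c ≤ j)
    (.le hD hF hSF ha ha0 (hf.comp .fst) .snd)).congr fun _ =>
      ⟨fun h j => h ▸ Nat.zero_le j, fun h => Nat.le_zero.1 (h 0)⟩

theorem DefinableMap.add_const {f : C → ℕ} (hf : DefinableMap L F a f) (m : ℕ) :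
    DefinableMap L F a fun c => f c + m :=
  (DefinablePred.eq (C := C × ℕ) DefinableMap.snd.pow_base
    ((hf.comp .fst).pow_base.pow_const hD m)).congr fun x => by
      rw [← Module.End.mul_apply, ← pow_add, add_comm m]
      exact ⟨fun h => by rw [h], fun h => pow_left_injective hF hSF ha ha0 h⟩

/-- `F^i s` is the one element of the orbit of `s` that is equivalent to `F^i a` in the preorder. -/
theorem DefinableMap.pow {s : Γ} (hs : s ∈ S) (hs0 : s ≠ 0) {f : C → ℕ}
    (hf : DefinableMap L F a f) : DefinableMap L F a fun c => (F ^ f c) s := by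
  have h : DefinableMap L F a fun i : ℕ => (F ^ i) s := by
    refine ((DefinablePred.orbit hD hs hs0 .snd).and
      ((DefinablePred.preceq hD DefinableMap.fst.pow_base .snd).and
        (DefinablePred.preceq hD .snd DefinableMap.fst.pow_base))).congr ?_
    rintro ⟨i, x⟩
    constructor
    · intro h
      dsimp only at h ⊢
      rw [h, preceq_pow_iff hF hSF ha ha0 hs hs0, preceq_pow_iff hF hSF hs hs0 ha ha0]
      exact ⟨⟨i, rfl⟩, le_rfl, le_rfl⟩
    · rintro ⟨⟨j, hj⟩, h1, h2⟩
      dsimp only at hj h1 h2 ⊢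
      rw [hj, preceq_pow_iff hF hSF ha ha0 hs hs0] at h1
      rw [hj, preceq_pow_iff hF hSF hs hs0 ha ha0] at h2
      rw [hj, le_antisymm h1 h2]
  exact h.comp hf

theorem DefinablePred.isShort (h0 : (0 : Γ) ∈ S) {f : C → ℕ} {g : C → Γ}
    (hf : DefinableMap L F a f) (hg : DefinableMap L F a g) :
    DefinablePred L F a fun c => IsShort F S (f c) (g c) :=
  ((DefinablePred.eq hg (.zero hD)).or (DefinablePred.ex
    (p := fun c x => LastTerm F S (g c) x ∧ Preceq F S x ((F ^ f c) a) ∧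
      ¬ Preceq F S ((F ^ f c) a) x)
    ((DefinablePred.lastTerm hD (hg.comp .fst) .snd).and
      ((DefinablePred.preceq hD .snd (hf.comp .fst).pow_base).and
        (DefinablePred.preceq hD (hf.comp .fst).pow_base .snd).not)))).congr
    fun _ => isShort_iff hF hSF h0 ha ha0 _ _

include hS hS₀

theorem DefinablePred.exists_eq_pow {f : C → ℕ} {g : C → Γ}
    (hf : DefinableMap L F a f) (hg : DefinableMap L F a g) :
    DefinablePred L F a fun c => ∃ k, g c = (F ^ f c) k :=
  (DefinablePred.preceq hD hf.pow_base (hg.firstTerm hD)).congr fun _ =>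
    exists_eq_pow_iff hF hS hSF hS₀ ha ha0 _ _

theorem DefinablePred.isTruncation {s : Γ} (hs : s ∈ S) (hs0 : s ≠ 0) {g : C → Γ} {f : C → ℕ}
    {h : C → Γ} (hg : DefinableMap L F a g) (hf : DefinableMap L F a f)
    (hh : DefinableMap L F a h) :
    DefinablePred L F a fun c => IsTruncation F S s (g c) (f c) (h c) := by
  have h1 := DefinablePred.isShort hD hF hSF ha ha0 hS.zero_mem hf hh
  have h2 : DefinablePred L F a fun c => ∃ k, (∃ k', k = (F ^ f c) k') ∧
      F (F (g c)) = h c + F (F ((F ^ f c) s)) + F (F (F k)) := by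
    refine DefinablePred.ex (p := fun c k => (∃ k', k = (F ^ f c) k') ∧
      F (F (g c)) = h c + F (F ((F ^ f c) s)) + F (F (F k))) ?_
    refine (DefinablePred.exists_eq_pow hD hF hS hSF hS₀ ha ha0 (hf.comp .fst) .snd).and
      (.eq (((hg.comp .fst).endo hD).endo hD) ?_)
    refine DefinableMap.add hD (.add hD (hh.comp .fst) ?_)
      (((DefinableMap.snd.endo hD).endo hD).endo hD)
    exact (((hf.comp .fst).pow hD hF hSF ha ha0 hs hs0).endo hD).endo hD
  refine (h1.and h2).congr fun c => and_congr_right fun _ => ?_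
  constructor
  · rintro ⟨k, hk⟩
    exact ⟨_, ⟨k, rfl⟩, hk⟩
  · rintro ⟨_, ⟨k, rfl⟩, hk⟩
    exact ⟨k, hk⟩

theorem DefinablePred.exists_gapped {s : Γ} (hs : s ∈ S) (hs0 : s ≠ 0) {g : C → Γ}
    (hg : DefinableMap L F a g) :
    DefinablePred L F a fun c => ∃ X, IsGapped X ∧ g c = sumAt F X s := by
  refine DefinablePred.congr ?_ fun c => exists_gapped_iff hF hS hSF hs hs0 (g c)
  have htr : ∀ {D : Type _} [Context L F a D] {g : D → Γ} {f : D → ℕ} {h : D → Γ},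
      DefinableMap L F a g → DefinableMap L F a f → DefinableMap L F a h →
      DefinablePred L F a fun c => IsTruncation F S s (g c) (f c) (h c) :=
    fun hg hf hh => DefinablePred.isTruncation hD hF hS hSF hS₀ ha ha0 hs hs0 hg hf hh
  have hpow : ∀ {D : Type _} [Context L F a D] {f : D → ℕ}, DefinableMap L F a f →
      DefinableMap L F a fun c => F (F ((F ^ f c) s)) :=
    fun hf => ((hf.pow hD hF hSF ha ha0 hs hs0).endo hD).endo hD
  refine (DefinablePred.eq hg (.zero hD)).or (DefinablePred.and ?_ ?_)
  · refine DefinablePred.ex (p := fun c (x : ℕ × Γ) => IsTruncation F S s (g c) x.1 x.2 ∧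
      F (F (g c)) = x.2 + F (F ((F ^ x.1) s))) ?_
    exact (htr (hg.comp .fst) (DefinableMap.fst.comp .snd) (DefinableMap.snd.comp .snd)).and
      (.eq (((hg.comp .fst).endo hD).endo hD)
        (.add hD (DefinableMap.snd.comp .snd) (hpow (DefinableMap.fst.comp .snd))))
  · refine DefinablePred.all (p := fun c (x : ℕ × Γ) => IsTruncation F S s (g c) x.1 x.2 →
      x.2 = 0 ∨ ∃ y : ℕ × Γ, IsTruncation F S s (g c) y.1 y.2 ∧ y.1 + 3 ≤ x.1 ∧
          x.2 = y.2 + F (F ((F ^ y.1) s))) ?_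
    refine (htr (hg.comp .fst) (DefinableMap.fst.comp .snd) (DefinableMap.snd.comp .snd)).imp
      ((DefinablePred.eq (DefinableMap.snd.comp .snd) (.zero hD)).or ?_)
    refine DefinablePred.ex (p := fun (x : C × ℕ × Γ) (y : ℕ × Γ) =>
      IsTruncation F S s (g x.1) y.1 y.2 ∧ y.1 + 3 ≤ x.2.1 ∧
          x.2.2 = y.2 + F (F ((F ^ y.1) s))) ?_
    refine (htr (hg.comp (DefinableMap.fst.comp .fst)) (DefinableMap.fst.comp .snd)
      (DefinableMap.snd.comp .snd)).and (DefinablePred.and ?_ ?_)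
    · exact .le hD hF hSF ha ha0 ((DefinableMap.fst.comp .snd).add_const hD hF hSF ha ha0 3)
        (DefinableMap.fst.comp (DefinableMap.snd.comp .fst))
    · exact .eq (DefinableMap.snd.comp (DefinableMap.snd.comp .fst))
        (.add hD (DefinableMap.snd.comp .snd) (hpow (DefinableMap.fst.comp .snd)))

/-- The digits of a sum over a gapped set are definable. -/
theorem DefinablePred.exists_isTruncation {s : Γ} (hs : s ∈ S) (hs0 : s ≠ 0) {g : C → Γ}
    {f : C → ℕ} (hg : DefinableMap L F a g) (hf : DefinableMap L F a f) :
    DefinablePred L F a fun c => ∃ z, IsTruncation F S s (g c) (f c) z :=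
  DefinablePred.ex (p := fun c z => IsTruncation F S s (g c) (f c) z)
    (.isTruncation hD hF hS hSF hS₀ ha ha0 hs hs0 (hg.comp .fst) (hf.comp .fst) .snd)

/-- For a letter `t`, the digits of both sums can be read off and compared. A general `t` is handled
along a word, since `sumAt` is additive in `t` and commutes with `F`. -/
theorem DefinablePred.exists_sumAt_pair (t : Γ) {g h : C → Γ} (hg : DefinableMap L F a g)
    (hh : DefinableMap L F a h) : DefinablePred L F a fun c =>
      ∃ X, IsGapped X ∧ g c = sumAt F X a ∧ h c = sumAt F X t := by
  have hcode : ∀ {D : Type _} [Context L F a D] {s : Γ} {g : D → Γ}, s ∈ S → s ≠ 0 →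
      DefinableMap L F a g → DefinablePred L F a fun c => ∃ X, IsGapped X ∧ g c = sumAt F X s :=
    fun hs hs0 hg => DefinablePred.exists_gapped hD hF hS hSF hS₀ ha ha0 hs hs0 hg
  have hzero : DefinablePred L F a fun x : Γ × Γ =>
      ∃ X, IsGapped X ∧ x.1 = sumAt F X a ∧ x.2 = sumAt F X 0 := by
    refine ((hcode ha ha0 .fst).and (.eq .snd (.zero hD))).congr fun x => ?_
    simp only [sumAt_zero]
    constructor
    · rintro ⟨X, hX, h1, h2⟩
      exact ⟨⟨X, hX, h1⟩, h2⟩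
    · rintro ⟨⟨X, hX, h1⟩, h2⟩
      exact ⟨X, hX, h1, h2⟩
  have hletter : ∀ s ∈ S, DefinablePred L F a fun x : Γ × Γ =>
      ∃ X, IsGapped X ∧ x.1 = sumAt F X a ∧ x.2 = sumAt F X s := by
    intro s hs
    by_cases hs0 : s = 0
    · rw [hs0]
      exact hzero
    have hbit : DefinablePred L F a fun x : Γ × Γ => ∀ i : ℕ,
        (∃ z, IsTruncation F S a x.1 i z) ↔ ∃ z, IsTruncation F S s x.2 i z :=
      DefinablePred.all (p := fun (x : Γ × Γ) (i : ℕ) =>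
        (∃ z, IsTruncation F S a x.1 i z) ↔ ∃ z, IsTruncation F S s x.2 i z)
        ((DefinablePred.exists_isTruncation hD hF hS hSF hS₀ ha ha0 ha ha0
          (DefinableMap.fst.comp .fst) .snd).iff
          (DefinablePred.exists_isTruncation hD hF hS hSF hS₀ ha ha0 hs hs0
          (DefinableMap.snd.comp .fst) .snd))
    refine (((hcode ha ha0 .fst).and (hcode hs hs0 .snd)).and hbit).congr ?_
    rintro ⟨x, y⟩
    constructor
    · rintro ⟨X, hX, h1, h2⟩
      refine ⟨⟨⟨X, hX, h1⟩, ⟨X, hX, h2⟩⟩, fun i => ?_⟩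
      dsimp only at h1 h2 ⊢
      simp only [h1, h2, isTruncation_iff hF hS hSF ha ha0 hX,
        isTruncation_iff hF hS hSF hs hs0 hX, exists_and_left, exists_eq]
    · rintro ⟨⟨⟨X, hX, h1⟩, ⟨Y, hY, h2⟩⟩, h⟩
      dsimp only at h1 h2 h
      simp only [h1, h2, isTruncation_iff hF hS hSF ha ha0 hX,
        isTruncation_iff hF hS hSF hs hs0 hY, exists_and_left, exists_eq, and_true] at h
      obtain rfl : X = Y := Finset.ext h
      exact ⟨X, hX, h1, h2⟩
  have key : ∀ w : List Γ, (∀ s ∈ w, s ∈ S) → DefinablePred L F a fun x : Γ × Γ =>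
      ∃ X, IsGapped X ∧ x.1 = sumAt F X a ∧ x.2 = sumAt F X (wordValue F w) := by
    intro w
    induction w with
    | nil => exact fun _ => hzero
    | cons s w ih =>
      intro hw
      have h1 := (hletter s (hw s List.mem_cons_self)).comp (C := (Γ × Γ) × Γ × Γ)
        ((DefinableMap.fst.comp .fst).prodMk (DefinableMap.fst.comp .snd))
      have h2 := (ih fun c hc => hw c (List.mem_cons_of_mem _ hc)).comp (C := (Γ × Γ) × Γ × Γ)
        ((DefinableMap.fst.comp .fst).prodMk (DefinableMap.snd.comp .snd))
      have h3 : DefinablePred L F a fun x : (Γ × Γ) × Γ × Γ => x.1.2 = x.2.1 + F x.2.2 :=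
        .eq (DefinableMap.snd.comp .fst) (.add hD (DefinableMap.fst.comp .snd)
          ((DefinableMap.snd.comp .snd).endo hD))
      refine (DefinablePred.ex (p := fun (x : Γ × Γ) (y : Γ × Γ) =>
        ((∃ X, IsGapped X ∧ x.1 = sumAt F X a ∧ y.1 = sumAt F X s) ∧
        (∃ X, IsGapped X ∧ x.1 = sumAt F X a ∧ y.2 = sumAt F X (wordValue F w))) ∧
        x.2 = y.1 + F y.2) ((h1.and h2).and h3)).congr ?_
      rintro ⟨x, y⟩
      constructor
      · rintro ⟨X, hX, h1, h2⟩
        refine ⟨(sumAt F X s, sumAt F X (wordValue F w)),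
          ⟨⟨X, hX, h1, rfl⟩, ⟨X, hX, h1, rfl⟩⟩, ?_⟩
        rw [map_sumAt, ← sumAt_add]
        exact h2
      · rintro ⟨⟨y₁, y₂⟩, ⟨⟨X, hX, h1, h2⟩, ⟨Y, hY, h3, h4⟩⟩, h⟩
        dsimp only at h1 h2 h3 h4 h
        -- The sets for the letter and for the rest of the word agree because both have the code
        -- `x`.
        obtain rfl := eq_of_sumAt_eq hF hS hSF ha ha0 hX hY (h1.symm.trans h3)
        refine ⟨X, hX, h1, ?_⟩
        dsimp only
        rw [h, h2, h4, map_sumAt, ← sumAt_add, wordValue]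
  obtain ⟨w, hw, rfl⟩ := hS.exists_word t
  exact (key w hw).comp (hg.prodMk hh)

end Definability

/-! ### Paths in a finite graph as families of sets of positions. -/

section Paths

variable {P : Type v}

/-- `ρ 0, …, ρ ℓ` is a path from an initial to a final vertex. -/
structure IsPath (init final : P → Prop) (step : P → P → Prop) (l : ℕ) (ρ : ℕ → P) : Prop where
  init : init (ρ 0)
  step : ∀ i < l, step (ρ i) (ρ (i + 1))
  final : final (ρ l)

/-- The sets `{i | B p i}` are the sets of all multiples `m i` such that `ρ i = p`, for some path
`ρ` from an initial to a final vertex. -/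
structure TracesPath (init final : P → Prop) (step : P → P → Prop) (m : ℕ) (B : P → ℕ → Prop) :
    Prop where
  unique : ∀ i p q, B p i → B q i → p = q
  pred : ∀ i p, B p i → (i = 0 ∧ init p) ∨ ∃ j q, B q j ∧ i = j + m ∧ step q p
  final : ∃ i p, B p i ∧ final p ∧ ∀ j q, B q j → j ≤ i

variable {init final : P → Prop} {step : P → P → Prop} {m : ℕ}

theorem IsPath.tracesPath {l : ℕ} {ρ : ℕ → P} (h : IsPath init final step l ρ) (hm : 0 < m) :
    TracesPath init final step m fun p k => ∃ i ≤ l, ρ i = p ∧ k = m * i where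
  unique := by
    rintro _ _ _ ⟨i, -, rfl, rfl⟩ ⟨j, -, rfl, hij⟩
    rw [Nat.eq_of_mul_eq_mul_left hm hij]
  pred := by
    rintro _ _ ⟨i, hi, rfl, rfl⟩
    cases i with
    | zero => exact Or.inl ⟨rfl, h.init⟩
    | succ i => exact Or.inr ⟨m * i, ρ i, ⟨i, by omega, rfl, rfl⟩, rfl, h.step i hi⟩
  final := by
    refine ⟨m * l, ρ l, ⟨l, le_rfl, rfl, rfl⟩, h.final, ?_⟩
    rintro _ _ ⟨i, hi, rfl, rfl⟩
    exact Nat.mul_le_mul_left m hi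

/-- Going back from the greatest position through predecessors, which are smaller as `m > 0`,
produces a path from the start. -/
theorem TracesPath.exists_isPath {B : P → ℕ → Prop} (h : TracesPath init final step m B)
    (hm : 0 < m) : ∃ l ρ, IsPath init final step l ρ ∧
      ∀ p k, B p k ↔ ∃ i ≤ l, ρ i = p ∧ k = m * i := by
  have key : ∀ k p, B p k → ∃ i ρ, k = m * i ∧ IsPath init (· = p) step i ρ ∧
      ∀ j ≤ i, B (ρ j) (m * j) := by
    intro k
    induction k using Nat.strong_induction_on with
    | _ k ih =>
      intro p hp
      rcases h.pred k p hp with ⟨rfl, hi⟩ | ⟨j, q, hq, rfl, hqp⟩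
      · refine ⟨0, fun _ => p, rfl, ⟨hi, by simp, rfl⟩, fun j hj => ?_⟩
        rwa [Nat.le_zero.1 hj]
      · obtain ⟨i, ρ, rfl, hρ, hB⟩ := ih j (by omega) q hq
        have hne : ∀ j ≤ i, Function.update ρ (i + 1) p j = ρ j := fun j hj =>
          Function.update_of_ne (by omega) _ _
        refine ⟨i + 1, Function.update ρ (i + 1) p, by ring, ⟨?_, fun j hj => ?_, ?_⟩,
          fun j hj => ?_⟩
        · rw [hne 0 (Nat.zero_le i)]
          exact hρ.init
        · rw [hne j (by omega)]
          rcases (Nat.lt_succ_iff.1 hj).eq_or_lt with rfl | hj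
          · rw [Function.update_self]
            exact hρ.final ▸ hqp
          · rw [hne (j + 1) hj]
            exact hρ.step j hj
        · exact Function.update_self _ _ _
        · rcases hj.eq_or_lt with rfl | hj
          · rw [Function.update_self]
            exact hp
          · rw [hne j (by omega)]
            exact hB j (by omega)
  obtain ⟨k, p, hp, hpf, hmax⟩ := h.final
  obtain ⟨l, ρ, rfl, hρ, hB⟩ := key k p hp
  refine ⟨l, ρ, ⟨hρ.init, hρ.step, hρ.final ▸ hpf⟩, fun q k => ⟨fun hq => ?_, ?_⟩⟩
  -- Every other pair also sits at a multiple of `m`, at most the greatest position; there the path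
  -- already has a vertex, and by `unique` it is the same one.
  · obtain ⟨i, -, rfl, -, -⟩ := key k q hq
    have hi : i ≤ l := Nat.le_of_mul_le_mul_left (hmax _ q hq) hm
    exact ⟨i, hi, h.unique _ _ _ (hB i hi) hq, rfl⟩
  · rintro ⟨i, hi, rfl, rfl⟩
    exact hB i hi

theorem IsPath.counter_eq {l : ℕ} {ρ : ℕ → P} (h : IsPath init final step l ρ) {c : P → ZMod 3}
    (hc : ∀ p q, step p q → c q = c p + 1) {i : ℕ} (hi : i ≤ l) : c (ρ i) = c (ρ 0) + i := by
  induction i with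
  | zero => simp
  | succ i ih =>
    rw [hc _ _ (h.step i hi), ih (by omega)]
    push_cast
    ring

variable {Γ : Type u} [AddCommGroup Γ] (F : Module.End ℤ Γ)

/-- The sum along a path is regrouped by vertices. The counter `c` separates two visits to the same
vertex by at least three steps, which makes the sets gapped. -/
theorem exists_isPath_iff [Fintype P] {c : P → ZMod 3} (hc : ∀ p q, step p q → c q = c p + 1)
    (hm : 0 < m) {ι : Type w} (value : P → ι → Γ) (x : ι → Γ) :
    (∃ l ρ, IsPath init final step l ρ ∧
      ∀ j, x j = ∑ i ∈ Finset.range (l + 1), (F ^ (m * i)) (value (ρ i) j)) ↔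
    ∃ X : P → Finset ℕ, (∀ p, IsGapped (X p)) ∧
      TracesPath init final step m (fun p k => k ∈ X p) ∧
      ∀ j, x j = ∑ p, sumAt F (X p) (value p j) := by
  classical
  have hsum : ∀ (l : ℕ) (ρ : ℕ → P) (X : P → Finset ℕ),
      (∀ p k, k ∈ X p ↔ ∃ i ≤ l, ρ i = p ∧ k = m * i) → ∀ j,
      ∑ i ∈ Finset.range (l + 1), (F ^ (m * i)) (value (ρ i) j) =
        ∑ p, sumAt F (X p) (value p j) := by
    intro l ρ X hX j
    rw [← Finset.sum_fiberwise (Finset.range (l + 1)) ρ]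
    refine Finset.sum_congr rfl fun p _ => ?_
    have : X p = ((Finset.range (l + 1)).filter (ρ · = p)).image (m * ·) := by
      ext k
      rw [hX]
      simp only [Finset.mem_image, Finset.mem_filter, Finset.mem_range, Nat.lt_succ_iff,
        and_assoc, eq_comm (a := k)]
    rw [sumAt, this, Finset.sum_image fun i _ j _ h => Nat.eq_of_mul_eq_mul_left hm h]
    exact Finset.sum_congr rfl fun i hi => by rw [(Finset.mem_filter.1 hi).2]
  constructor
  · rintro ⟨l, ρ, hρ, hx⟩
    have hX : ∀ p k, k ∈ ((Finset.range (l + 1)).filter (ρ · = p)).image (m * ·) ↔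
        ∃ i ≤ l, ρ i = p ∧ k = m * i := fun p k => by
      simp only [Finset.mem_image, Finset.mem_filter, Finset.mem_range, Nat.lt_succ_iff,
        and_assoc, eq_comm (a := k)]
    refine ⟨fun p => ((Finset.range (l + 1)).filter (ρ · = p)).image (m * ·), fun p => ?_, ?_,
      fun j => (hx j).trans (hsum l ρ _ hX j)⟩
    · intro k hk k' hk' hkk
      obtain ⟨i, hi, hip, rfl⟩ := (hX p k).1 hk
      obtain ⟨i', hi', hip', rfl⟩ := (hX p k').1 hk'
      have hii := Nat.lt_of_mul_lt_mul_left hkk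
      have h1 := hρ.counter_eq hc hi
      rw [hip, ← hip', hρ.counter_eq hc hi', add_right_inj,
        ZMod.natCast_eq_natCast_iff'] at h1
      have h3 : i + 3 ≤ i' := by omega
      have : m * (i + 3) ≤ m * i' := Nat.mul_le_mul_left m h3
      nlinarith
    · simp only [hX]
      exact hρ.tracesPath hm
  · rintro ⟨X, -, hX, hx⟩
    obtain ⟨l, ρ, hρ, hB⟩ := hX.exists_isPath hm
    exact ⟨l, ρ, hρ, fun j => (hx j).trans (hsum l ρ X hB j).symm⟩

end Paths

/-! ### Values of paths are definable. -/

section Definability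

open FirstOrder

variable {Γ : Type u} [AddCommGroup Γ] {F : Module.End ℤ Γ} {S S₀ : Finset Γ}
  {L : FirstOrder.Language.{v, w}} [L.Structure Γ] {a : Γ}

theorem DefinesExpansion.codesNat (hD : DefinesExpansion L F S S₀) (hF : Function.Injective F)
    (hSF : ∀ a ∈ S, ∀ x : Γ, a = F x → a = 0) (ha : a ∈ S) (ha0 : a ≠ 0) : CodesNat L F a :=
  ⟨pow_left_injective hF hSF ha ha0, hD.orbit a ha ha0⟩

variable (hD : DefinesExpansion L F S S₀) (hF : Function.Injective F) (hS : IsSpanning F S)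
  (hSF : ∀ a ∈ S, ∀ x : Γ, a = F x → a = 0) (hS₀ : IsTransversal F S S₀)
  (ha : a ∈ S) (ha0 : a ≠ 0)

include hD hF hSF ha ha0 in
theorem DefinablePred.tracesPath [CodesNat L F a] {C : Type*} [Context L F a C] {P : Type}
    [Finite P] (init final : P → Prop) (step : P → P → Prop) (m : ℕ) {B : C → P → ℕ → Prop}
    (hB : ∀ p, DefinablePred L F a fun x : C × ℕ => B x.1 p x.2) :
    DefinablePred L F a fun c => TracesPath init final step m (B c) := by
  have h1 : DefinablePred L F a fun c => ∀ i p q, B c p i → B c q i → p = q :=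
    .all (p := fun c i => ∀ p q, B c p i → B c q i → p = q)
      (.all_finite fun p => .all_finite fun q => (hB p).imp ((hB q).imp (.const _)))
  have h2 : DefinablePred L F a fun c => ∀ i p, B c p i →
      (i = 0 ∧ init p) ∨ ∃ j q, B c q j ∧ i = j + m ∧ step q p := by
    refine .all (p := fun c i => ∀ p, B c p i →
      (i = 0 ∧ init p) ∨ ∃ j q, B c q j ∧ i = j + m ∧ step q p) (.all_finite fun p =>
        (hB p).imp (.or (.and (.eq_zero hD hF hSF ha ha0 .snd) (.const _)) ?_))
    refine .ex (p := fun (x : C × ℕ) j => ∃ q, B x.1 q j ∧ x.2 = j + m ∧ step q p)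
      (.ex_finite fun q => .and ?_ (.and ?_ (.const _)))
    · exact (hB q).comp ((DefinableMap.fst.comp .fst).prodMk .snd)
    · exact .eq (DefinableMap.snd.comp .fst) (.add_const hD hF hSF ha ha0 .snd m)
  have h3 : DefinablePred L F a fun c => ∃ i p, B c p i ∧ final p ∧ ∀ j q, B c q j → j ≤ i := by
    refine .ex (p := fun c i => ∃ p, B c p i ∧ final p ∧ ∀ j q, B c q j → j ≤ i)
      (.ex_finite fun p => (hB p).and (.and (.const _) ?_))
    refine .all (p := fun (x : C × ℕ) j => ∀ q, B x.1 q j → j ≤ x.2) (.all_finite fun q => .imp ?_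
      (.le hD hF hSF ha ha0 .snd (DefinableMap.snd.comp .fst)))
    exact (hB q).comp ((DefinableMap.fst.comp .fst).prodMk .snd)
  exact (h1.and (h2.and h3)).congr fun c =>
    ⟨fun h => ⟨h.unique, h.pred, h.final⟩, fun h => ⟨h.1, h.2.1, h.2.2⟩⟩

include hD hF hS hSF hS₀ ha ha0

/-- The set of values of the paths of a finite graph is definable. -/
theorem definable_path_values {P : Type} [Finite P] {init final : P → Prop} {step : P → P → Prop}
    {c : P → ZMod 3} (hc : ∀ p q, step p q → c q = c p + 1) {m : ℕ} (hm : 0 < m)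
    {ι : Type} [Finite ι] (value : P → ι → Γ) :
    (∅ : Set Γ).Definable L {x : ι → Γ | ∃ l ρ, IsPath init final step l ρ ∧
      ∀ j, x j = ∑ i ∈ Finset.range (l + 1), (F ^ (m * i)) (value (ρ i) j)} := by
  have := hD.codesNat hF hSF ha ha0
  have := Fintype.ofFinite P
  apply DefinablePred.definable (F := F) (a := a)
  have h1 : DefinablePred L F a fun x : (ι → Γ) × (P → Γ) × (P × ι → Γ) =>
      ∀ p, ∃ X, IsGapped X ∧ x.2.1 p = sumAt F X a :=
    .all_finite fun p => .exists_gapped hD hF hS hSF hS₀ ha ha0 ha ha0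
      (.eval p (DefinableMap.fst.comp .snd))
  have h2 : DefinablePred L F a fun x : (ι → Γ) × (P → Γ) × (P × ι → Γ) =>
      TracesPath init final step m fun p i => ∃ z, IsTruncation F S a (x.2.1 p) i z :=
    .tracesPath hD hF hSF ha ha0 _ _ _ _ fun p =>
      .exists_isTruncation hD hF hS hSF hS₀ ha ha0 ha ha0
        (.eval p (DefinableMap.fst.comp (DefinableMap.snd.comp .fst))) .snd
  have h3 : DefinablePred L F a fun x : (ι → Γ) × (P → Γ) × (P × ι → Γ) =>
      ∀ p j, ∃ X, IsGapped X ∧ x.2.1 p = sumAt F X a ∧ x.2.2 (p, j) = sumAt F X (value p j) :=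
    .all_finite fun p => .all_finite fun j =>
      .exists_sumAt_pair hD hF hS hSF hS₀ ha ha0 (value p j)
        (.eval p (DefinableMap.fst.comp .snd)) (.eval (p, j) (DefinableMap.snd.comp .snd))
  have h4 : DefinablePred L F a fun x : (ι → Γ) × (P → Γ) × (P × ι → Γ) =>
      ∀ j, x.1 j = ∑ p, x.2.2 (p, j) :=
    .all_finite fun j => .eq (.eval j .fst)
      (.sum hD _ fun p => .eval (p, j) (DefinableMap.snd.comp .snd))
  -- The quantified data are the code of the set of each vertex and, for each vertex and coordinate,
  -- the sum of the contributions made there.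
  refine (DefinablePred.ex (p := fun (x : ι → Γ) (y : (P → Γ) × (P × ι → Γ)) =>
    (((∀ p, ∃ X, IsGapped X ∧ y.1 p = sumAt F X a) ∧
    (TracesPath init final step m fun p i => ∃ z, IsTruncation F S a (y.1 p) i z)) ∧
    (∀ p j, ∃ X, IsGapped X ∧ y.1 p = sumAt F X a ∧ y.2 (p, j) = sumAt F X (value p j))) ∧
    ∀ j, x j = ∑ p, y.2 (p, j)) (((h1.and h2).and h3).and h4)).congr fun x => ?_
  rw [exists_isPath_iff F hc hm value x]
  have htr : ∀ X, IsGapped X → ∀ i, (∃ z, IsTruncation F S a (sumAt F X a) i z) ↔ i ∈ X := by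
    intro X hX i
    simp [isTruncation_iff hF hS hSF ha ha0 hX]
  constructor
  · rintro ⟨X, hX, hB, hx⟩
    refine ⟨(fun p => sumAt F (X p) a, fun y => sumAt F (X y.1) (value y.1 y.2)),
      ⟨⟨fun p => ⟨X p, hX p, rfl⟩, ?_⟩, fun p j => ⟨X p, hX p, rfl, rfl⟩⟩, hx⟩
    simp only [htr _ (hX _)]
    exact hB
  · rintro ⟨⟨e, h⟩, ⟨⟨hX, hB⟩, hh⟩, hx⟩
    dsimp only at hX hB hh hx
    choose X hX he using hX
    refine ⟨X, hX, ?_, fun j => (hx j).trans (Finset.sum_congr rfl fun p _ => ?_)⟩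
    · simp only [he, htr _ (hX _)] at hB
      exact hB
    · obtain ⟨Y, hY, h1, h2⟩ := hh p j
      rw [h2, eq_of_sumAt_eq hF hS hSF ha ha0 (hX p) hY ((he p).symm.trans h1)]

end Definability

/-! ### Runs of an automaton as paths. -/

section Runs

variable {Γ : Type u} [AddCommGroup Γ] (F : Module.End ℤ Γ) {Λ : Type v} {σ : Type w}
  (M : DFA Λ σ)

/-- The edges of the graph of runs of `M`: a vertex consists of a state, the letter that has been
read last, and the number of letters modulo three. -/
def runStep (p q : σ × Option Λ × ZMod 3) : Prop :=
  ∃ c, q = (M.step p.1 c, some c, p.2.2 + 1)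

/-- The values of the words accepted by `M`, shifted by one letter, are the values of the paths in
the graph of runs. -/
theorem exists_accepts_iff {ι : Type*} (val : Λ → ι → Γ) (m : ℕ) (x : ι → Γ) :
    (∃ y ∈ M.accepts, ∀ j, (F ^ m) (wordValue (F ^ m) (y.map fun c => val c j)) = x j) ↔
      ∃ l ρ, IsPath (· = (M.start, none, 0)) (fun p => p.1 ∈ M.accept) (runStep M) l ρ ∧
        ∀ j, x j = ∑ i ∈ Finset.range (l + 1),
          (F ^ (m * i)) ((ρ i).2.1.elim 0 fun c => val c j) := by
  constructor
  · rintro ⟨y, hy, hx⟩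
    -- A vertex stores the letter already read, so the initial vertex has none and contributes `0`.
    -- Letter number `i` is thus counted at position `i + 1`, whence the factor `F ^ m`.
    refine ⟨y.length, fun i => (M.eval (y.take i), (if i = 0 then none else y[i - 1]?), i),
      ⟨by simp, fun i hi => ⟨y[i], ?_⟩, by simpa [DFA.mem_accepts] using hy⟩, fun j => ?_⟩
    · have htake : y.take (i + 1) = y.take i ++ [y[i]] := List.take_succ_eq_append_getElem hi
      dsimp only
      rw [htake, M.eval_append_singleton, if_neg (Nat.succ_ne_zero i), Nat.add_sub_cancel,
        List.getElem?_eq_getElem hi, Nat.cast_succ]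
    · have hmap : y.map (fun c => val c j) =
          (List.range y.length).map fun i => (y[i]?).elim 0 fun c => val c j := by
        refine List.ext_getElem (by simp) fun i hi hi' => ?_
        rw [List.length_map] at hi
        simp [hi]
      rw [← hx, hmap, wordValue_map_range, Finset.sum_range_succ', map_sum]
      simp only [← pow_mul, ← Module.End.mul_apply, ← pow_add]
      simp [Nat.mul_add, add_comm]
  · rintro ⟨l, ρ, hρ, hx⟩
    have key : ∀ k ≤ l, ∃ y : List Λ, y.length = k ∧ M.eval y = (ρ k).1 ∧
        ∀ j, (F ^ m) (wordValue (F ^ m) (y.map fun c => val c j)) =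
          ∑ i ∈ Finset.range (k + 1), (F ^ (m * i)) ((ρ i).2.1.elim 0 fun c => val c j) := by
      intro k
      induction k with
      | zero => exact fun _ => ⟨[], rfl, by simp [hρ.init], by simp [hρ.init, wordValue]⟩
      | succ k ih =>
        intro hk
        obtain ⟨y, rfl, hy, hval⟩ := ih (by omega)
        obtain ⟨c, hc⟩ := hρ.step _ hk
        refine ⟨y ++ [c], by simp, by rw [M.eval_append_singleton, hy, hc], fun j => ?_⟩
        rw [Finset.sum_range_succ, ← hval, hc, List.map_append, wordValue_append, map_add,
          List.length_map, ← pow_mul, ← Module.End.mul_apply, ← pow_add, Nat.mul_succ,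
          add_comm m]
        simp [wordValue]
    obtain ⟨y, -, hy, hval⟩ := key l le_rfl
    exact ⟨y, by rw [DFA.mem_accepts, hy]; exact hρ.final, fun j => (hval j).trans (hx j).symm⟩

end Runs

/-! ### Automatic sets are definable. -/

section Definability

open FirstOrder

variable {Γ : Type u} [AddCommGroup Γ] {F : Module.End ℤ Γ} {S S₀ : Finset Γ}

theorem subsingleton_of_forall_eq_zero (hS : IsSpanning F S) (h : ∀ a ∈ S, a = 0) :
    Subsingleton Γ := by
  have : ∀ g : Γ, g = 0 := fun g => by
    obtain ⟨x, hx, rfl⟩ := hS.exists_word g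
    exact wordValue_eq_zero F fun a ha => h a (hx a ha)
  exact ⟨fun x y => (this x).trans (this y).symm⟩

variable {L : FirstOrder.Language.{v, w}} [L.Structure Γ]

theorem definable_of_isFAutomatic (hD : DefinesExpansion L F S S₀) (hF : Function.Injective F)
    (hS : IsSpanning F S) (hSF : ∀ a ∈ S, ∀ x : Γ, a = F x → a = 0) (hS₀ : IsTransversal F S S₀)
    {n : ℕ} {A : Set (Fin n → Γ)} (hA : IsFAutomatic F A) : (∅ : Set Γ).Definable L A := by
  -- Without a nonzero letter there is no code for the natural numbers, but then `Γ` is trivial.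
  by_cases h : ∀ a ∈ S, a = 0
  · have := subsingleton_of_forall_eq_zero hS h
    rcases Subsingleton.set_cases (p := fun A => (∅ : Set Γ).Definable L A)
      Set.definable_empty Set.definable_univ A with h
    exact h
  push Not at h
  obtain ⟨a, ha, ha0⟩ := h
  obtain ⟨m, hm, T, hT, σ, _, M, hM⟩ := hA
  have hnat := hD.codesNat hF hSF ha ha0
  let val : (Fin n → Option T) → Fin n → Γ := fun c i => (c i).elim 0 Subtype.val
  -- The vertices are renamed by numbers because the coordinates of a context are indexed in `Type`.
  obtain ⟨N, ⟨e⟩⟩ := Finite.exists_equiv_fin (σ × Option (Fin n → Option T) × ZMod 3)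
  have hdef := definable_path_values hD hF hS hSF hS₀ ha ha0 (P := Fin N)
    (init := fun p => e.symm p = (M.start, none, 0)) (final := fun p => (e.symm p).1 ∈ M.accept)
    (step := fun p q => runStep M (e.symm p) (e.symm q)) (c := fun p => (e.symm p).2.2)
    (by rintro p q ⟨c, hc⟩; rw [hc]) hm
    fun p j => (e.symm p).2.1.elim 0 fun c => val c j
  have hacc : (∅ : Set Γ).Definable L {x : Fin n → Γ | ∃ y ∈ M.accepts,
      ∀ j, (F ^ m) (wordValue (F ^ m) (y.map fun c => val c j)) = x j} := by
    refine (congrArg (fun B => (∅ : Set Γ).Definable L B) (Set.ext fun x => ?_)).mpr hdef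
    refine (exists_accepts_iff F M val m x).trans ?_
    constructor
    · rintro ⟨l, ρ, ⟨h1, h2, h3⟩, hx⟩
      exact ⟨l, e ∘ ρ, ⟨by simpa using h1, by simpa using h2, by simpa using h3⟩,
        by simpa using hx⟩
    · rintro ⟨l, ρ, ⟨h1, h2, h3⟩, hx⟩
      exact ⟨l, e.symm ∘ ρ, ⟨h1, h2, h3⟩, hx⟩
  -- The shift by one digit is undone by pulling back along `F ^ m`, which is injective.
  have hpre : DefinablePred L F a fun x : Fin n → Γ => (fun j => (F ^ m) (x j)) ∈
      {x : Fin n → Γ | ∃ y ∈ M.accepts,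
        ∀ j, (F ^ m) (wordValue (F ^ m) (y.map fun c => val c j)) = x j} :=
    .mem hacc fun j => (DefinableMap.eval j IsSelection.id.definableMap).pow_const hD m
  refine (congrArg (fun B => (∅ : Set Γ).Definable L B) (Set.ext fun x => ?_)).mpr hpre.definable
  rw [hM]
  constructor
  · intro hx
    have hw : ∀ g : Γ, ∃ y : List T, wordValue (F ^ m) (y.map Subtype.val) = g := by
      intro g
      obtain ⟨y, hy, rfl⟩ := hT.exists_word g
      lift y to List T using hy
      exact ⟨y, rfl⟩
    choose y hy using hw
    refine ⟨_, ⟨fun i => y (x i), ?_, rfl⟩, fun j => ?_⟩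
    · rwa [Set.mem_ofPred_eq, show (fun i => wordValue (F ^ m) ((y (x i)).map Subtype.val)) = x
        from funext fun i => hy (x i)]
    · exact congrArg _ ((rowValue_convolution (F ^ m) Subtype.val _ j).trans (hy _))
  · rintro ⟨_, ⟨y, hy, rfl⟩, hx⟩
    have : x = fun i => wordValue (F ^ m) ((y i).map Subtype.val) := funext fun i =>
      pow_injective hF m (((hx i).symm).trans
        (congrArg _ (rowValue_convolution (F ^ m) Subtype.val y i)))
    rw [this]
    exact hy

end Definability

end FAutomata

theorem theorem4p18 {Γ : Type*} [AddCommGroup Γ] (F : Module.End ℤ Γ)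
    [Module.Finite (Polynomial ℤ) (Module.AEval' F)] (hF : Function.Injective F)
    (S : Finset Γ) (hS : FAutomata.IsSpanning F S)
    (hSF : ∀ a ∈ S, ∀ x : Γ, a = F x → a = 0)
    (S₀ : Finset Γ) (hS₀ : FAutomata.IsTransversal F S S₀) :
    letI := FAutomata.expansion F S S₀
    FAutomata.FAPresentable (FAutomata.expansionLanguage S) Γ ∧
      ∀ (P : Set Γ) (n : ℕ) (A : Set (Fin n → Γ)),
        P.Definable (FAutomata.expansionLanguage S) A ↔ FAutomata.IsFAutomatic F A := by
  refine ⟨FAutomata.faPresentable_expansion hF hS hSF hS₀, fun P n A =>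
    ⟨FAutomata.isFAutomatic_of_definable hF hS hSF hS₀, fun hA => ?_⟩⟩
  let := FAutomata.expansion F S S₀
  -- The formula obtained has no parameters, so it serves for every `P`.
  exact (FAutomata.definable_of_isFAutomatic (FAutomata.definesExpansion F S S₀) hF hS hSF hS₀
    hA).mono (Set.empty_subset P)
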